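/- Let $N\in\mathbb N$ and $1<p<N$, and let $\Omega\subset\mathbb R^N$ be an arbitrary open set (not necessarily bounded). Let $D^{1,p}(\Omega)$ be the completion of $C_c^\infty(\Omega)$ under the norm $\big(\int_\Omega|\nabla\varphi|^p\big)^{1/p}$, realised by the Sobolev inequality as a space of functions in $L^{p^*}(\Omega)$, $p^*=\frac{Np}{N-p}$, with weak gradient in $L^p(\Omega)$. Write $|\cdot|_r$ for the norm of $L^r(\Omega)$. Let $\lambda>0$, $q>N$ and $\beta>p$. Let $\mathcal A:\Omega\times\mathbb R\times\mathbb R^N\to\mathbb R^N$ and $\mathcal B:\Omega\times\mathbb R\times\mathbb R^N\to\mathbb R$ be Carathéodory functions (measurable in $x$, continuous in $(\zeta,\xi)$) such that, for a.e. $x\in\Omega$ and all $\zeta\in\mathbb R$, $\xi\in\mathbb R^N$, $$\mathcal A(x,\zeta,\xi)\cdot\xi\ \ge\ \lambda|\xi|^p-a_1(x)|\zeta|^p-a_2(x),\qquad |\mathcal B(x,\zeta,\xi)|\ \le\ b_1(x)|\xi|^{p-1}+b_2(x)|\zeta|^{p-1}+b_3(x),$$ with nonnegative functions $b_1\in L^\infty(\Omega)$,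 $a_1,b_2\in L^{q/p}(\Omega)$, $a_2\in L^{\beta/p}(\Omega)\cap L^\infty(\Omega)$ and $b_3\in L^{\beta/(p-1)}(\Omega)\cap L^\infty(\Omega)$. Put $$\|a_2\|:=|a_2|_{\beta/p}+|a_2|_\infty,\qquad \|b_3\|:=|b_3|_{\beta/(p-1)}+|b_3|_\infty .$$ Let $u\in D^{1,p}(\Omega)\cap L^\beta(\Omega)$ be a weak solution of $-\operatorname{div}\mathcal A(x,u,\nabla u)=\mathcal B(x,u,\nabla u)$, that is, for every $\varphi\in D^{1,p}(\Omega)$ the functions $\mathcal A(x,u,\nabla u)\cdot\nabla\varphi$ and $\mathcal B(x,u,\nabla u)\varphi$ are integrable on $\Omega$ and $$\int_\Omega\mathcal A(x,u,\nabla u)\cdot\nabla\varphi\,dx=\int_\Omega\mathcal B(x,u,\nabla u)\,\varphi\,dx .$$ Then $u\in L^\infty(\Omega)$ and $$|u|_\infty\ \le\ C\,\max\big\{1,\|a_2\|^{1/p},\|b_3\|^{1/(p-1)}\big\}\,\max\big\{|u|_\beta,|u|_\beta^{\theta_0}\big\},$$ where $\theta_0\in(0,1]$ depends only on $p,\beta,N$,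 and $C=C\big(p,q,\beta,N,\lambda,|b_1|_\infty,|a_1|_{q/p},|b_2|_{q/p}\big)$ depends only on the quantities listed and is nondecreasing in the three norms. -/

import Mathlib

open MeasureTheory Filter Topology

/-- The Sobolev exponent `p* = N p / (N - p)` (used for `1 < p < N` only). -/
noncomputable def sobolevExponent (N : ℕ) (p : ℝ) : ℝ :=
  (N : ℝ) * p / ((N : ℝ) - p)

/-- `u ∈ D^{1,p}(Ω)` with gradient `∇u = G`, for `1 < p < N` and `Ω` open in `ℝ^N`.

`D^{1,p}(Ω)` is the completion of `C_c^∞(Ω)` under `φ ↦ (∫_Ω |∇φ|^p)^{1/p}`. By the Sobolev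
inequality a sequence that is Cauchy in this norm converges in `L^{p*}(Ω)`, and its gradients converge
in `L^p(Ω)`; so the elements of the completion are the functions `u ∈ L^{p*}(Ω)` that are limits of
test functions `φ n` whose gradients converge in `L^p(Ω)`, and the limit `G` of the gradients is the
weak gradient of `u` (unique up to null sets). Only values on `Ω` matter. -/
structure MemBeppoLevi {N : ℕ} (p : ℝ) (Ω : Set (EuclideanSpace ℝ (Fin N)))
    (u : EuclideanSpace ℝ (Fin N) → ℝ)
    (G : EuclideanSpace ℝ (Fin N) → EuclideanSpace ℝ (Fin N)) : Prop where
  memLp_fun : MemLp u (ENNReal.ofReal (sobolevExponent N p)) (volume.restrict Ω)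
  memLp_grad : MemLp G (ENNReal.ofReal p) (volume.restrict Ω)
  exists_approx : ∃ φ : ℕ → EuclideanSpace ℝ (Fin N) → ℝ,
    (∀ n, ContDiff ℝ (⊤ : ℕ∞) (φ n) ∧ HasCompactSupport (φ n) ∧ tsupport (φ n) ⊆ Ω) ∧
    Tendsto (fun n => eLpNorm (fun x => φ n x - u x)
      (ENNReal.ofReal (sobolevExponent N p)) (volume.restrict Ω)) atTop (𝓝 0) ∧
    Tendsto (fun n => eLpNorm (fun x => gradient (φ n) x - G x)
      (ENNReal.ofReal p) (volume.restrict Ω)) atTop (𝓝 0)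

/-- `F : Ω × ℝ × ℝ^N → Y` is a Carathéodory function: Lebesgue measurable in `x`, and continuous in
`(ζ, ξ)` for almost every `x ∈ Ω`. -/
structure IsCaratheodory {N : ℕ} {Y : Type*} [TopologicalSpace Y]
    (Ω : Set (EuclideanSpace ℝ (Fin N)))
    (F : EuclideanSpace ℝ (Fin N) → ℝ → EuclideanSpace ℝ (Fin N) → Y) : Prop where
  measurable_left : ∀ (ζ : ℝ) (ξ : EuclideanSpace ℝ (Fin N)),
    AEStronglyMeasurable (fun x => F x ζ ξ) (volume.restrict Ω)
  continuous_right : ∀ᵐ x ∂(volume.restrict Ω),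
    Continuous (fun z : ℝ × EuclideanSpace ℝ (Fin N) => F x z.1 z.2)

/-- The structure condition `A(x,ζ,ξ)·ξ ≥ lam |ξ|^p - a₁(x) |ζ|^p - a₂(x)`. -/
def StructureA {N : ℕ} (p lam : ℝ) (Ω : Set (EuclideanSpace ℝ (Fin N)))
    (A : EuclideanSpace ℝ (Fin N) → ℝ → EuclideanSpace ℝ (Fin N) → EuclideanSpace ℝ (Fin N))
    (a₁ a₂ : EuclideanSpace ℝ (Fin N) → ℝ) : Prop :=
  ∀ᵐ x ∂(volume.restrict Ω), ∀ (ζ : ℝ) (ξ : EuclideanSpace ℝ (Fin N)),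
    lam * ‖ξ‖ ^ p - a₁ x * |ζ| ^ p - a₂ x ≤ inner ℝ (A x ζ ξ) ξ

/-- The structure condition `|B(x,ζ,ξ)| ≤ b₁(x) |ξ|^{p-1} + b₂(x) |ζ|^{p-1} + b₃(x)`. -/
def StructureB {N : ℕ} (p : ℝ) (Ω : Set (EuclideanSpace ℝ (Fin N)))
    (B : EuclideanSpace ℝ (Fin N) → ℝ → EuclideanSpace ℝ (Fin N) → ℝ)
    (b₁ b₂ b₃ : EuclideanSpace ℝ (Fin N) → ℝ) : Prop :=
  ∀ᵐ x ∂(volume.restrict Ω), ∀ (ζ : ℝ) (ξ : EuclideanSpace ℝ (Fin N)),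
    |B x ζ ξ| ≤ b₁ x * ‖ξ‖ ^ (p - 1) + b₂ x * |ζ| ^ (p - 1) + b₃ x

/-- `u`, with gradient `G`, is a weak `D^{1,p}(Ω)` solution of `-div A(x,u,∇u) = B(x,u,∇u)`: for every
`φ ∈ D^{1,p}(Ω)` the two integrals exist and `∫_Ω A(x,u,∇u)·∇φ = ∫_Ω B(x,u,∇u) φ`. -/
structure IsWeakSolution {N : ℕ} (p : ℝ) (Ω : Set (EuclideanSpace ℝ (Fin N)))
    (A : EuclideanSpace ℝ (Fin N) → ℝ → EuclideanSpace ℝ (Fin N) → EuclideanSpace ℝ (Fin N))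
    (B : EuclideanSpace ℝ (Fin N) → ℝ → EuclideanSpace ℝ (Fin N) → ℝ)
    (u : EuclideanSpace ℝ (Fin N) → ℝ)
    (G : EuclideanSpace ℝ (Fin N) → EuclideanSpace ℝ (Fin N)) : Prop where
  mem : MemBeppoLevi p Ω u G
  weak_eq : ∀ (φ : EuclideanSpace ℝ (Fin N) → ℝ)
    (Φ : EuclideanSpace ℝ (Fin N) → EuclideanSpace ℝ (Fin N)), MemBeppoLevi p Ω φ Φ →
      Integrable (fun x => inner ℝ (A x (u x) (G x)) (Φ x)) (volume.restrict Ω) ∧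
      Integrable (fun x => B x (u x) (G x) * φ x) (volume.restrict Ω) ∧
      ∫ x in Ω, inner ℝ (A x (u x) (G x)) (Φ x) = ∫ x in Ω, B x (u x) (G x) * φ x

/-- The norm `|f|_{r,Ω} + |f|_{∞,Ω}` of `L^r(Ω) ∩ L^∞(Ω)`. -/
noncomputable def lebSupNorm {N : ℕ} (Ω : Set (EuclideanSpace ℝ (Fin N))) (r : ENNReal)
    (f : EuclideanSpace ℝ (Fin N) → ℝ) : ℝ :=
  lpNorm f r (volume.restrict Ω) + lpNorm f ⊤ (volume.restrict Ω)

/-! The proof is a Moser iteration in which the powers of `s` and the defects of homogeneity are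
tracked explicitly. For `s ≥ β` with `|u|^s` integrable, the test function is the primitive along
`u` of `min(|t|,k)^(s-p)`. Its derivative is continuous and bounded, so only a C¹ chain rule is
needed (`MemBeppoLevi.intervalIntegral_comp`). The structure conditions and Young's inequality then
control the integral of `min(|u|,k)^(s-p) |∇u|^p` (`IsWeakSolution.energy_le`).

This integral is the p-energy of `W`, the primitive of `min(|t|,k)^((s-p)/p)` along `u`, so Sobolev
bounds the critical norm of `W`. The potentials `a₁`, `b₂` are subcritical because `q > N`: they
cost a large multiple of the integral of `|W|^p` and a small multiple of the critical term, which is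
absorbed. The source terms `a₂`, `b₃` are estimated by Hölder, uniformly in `s`. Letting `k → ∞`
gives a reverse Hölder inequality from exponent `s` to `s N/(N-p)`
(`IsControlledSolution.reverse_holder`).

The source terms carry lower powers of `|u|_s`. With `M = max {1, ‖a₂‖^(1/p), ‖b₃‖^(1/(p-1))}` and
`v = |u|_s / M`, everything is dominated by `max v (v^(1-p/s))`, so one step reads `v_{n+1} ≤
exp(k_n) max(v_n, v_n^(1-p/s_n))` with `s_n = β (N/(N-p))^n`. The sum of the `k_n` converges and the
product of the `1 - p/s_n` stays above a positive number `θ₀`, because `s_n` grows geometrically and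
`β > p`. The bounds on `|u|_{s_n}` are thus uniform in `n` and pass to the supremum. -/

/-! ### Chain rule in `D^{1,p}(Ω)`. -/

theorem tendsto_eLpNorm_bounded_smul {α E : Type*} [MeasurableSpace α] {μ : Measure α}
    [NormedAddCommGroup E] [NormedSpace ℝ E] {p : ENNReal} (hp0 : p ≠ 0) (hp : p ≠ ⊤)
    {h : ℕ → α → ℝ} {K : ℝ} (hm : ∀ n, AEStronglyMeasurable (h n) μ) (hK : ∀ n x, |h n x| ≤ K)
    (hlim : ∀ᵐ x ∂μ, Tendsto (fun n => h n x) atTop (𝓝 0)) {G : α → E} (hG : MemLp G p μ) :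
    Tendsto (fun n => eLpNorm (fun x => h n x • G x) p μ) atTop (𝓝 0) := by
  have hpr : 0 < p.toReal := ENNReal.toReal_pos hp0 hp
  have key : Tendsto (fun n => ∫⁻ x, ‖h n x • G x‖ₑ ^ p.toReal ∂μ) atTop
      (𝓝 (∫⁻ _, 0 ∂μ)) := by
    refine tendsto_lintegral_of_dominated_convergence'
      (fun x => ‖K‖ₑ ^ p.toReal * ‖G x‖ₑ ^ p.toReal) ?_ ?_ ?_ ?_
    · intro n
      exact ((hm n).smul hG.1).enorm.pow_const _
    · intro n
      refine Eventually.of_forall fun x => ?_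
      have h1 : ‖h n x‖ₑ ≤ ‖K‖ₑ := by
        rw [enorm_le_iff_norm_le]
        exact (hK n x).trans (le_abs_self K)
      simp only [enorm_smul]
      rw [ENNReal.mul_rpow_of_nonneg _ _ hpr.le]
      gcongr
    · rw [lintegral_const_mul'' _ (hG.1.enorm.pow_const _)]
      refine ENNReal.mul_ne_top (by simp [hpr.le]) ?_
      exact (lintegral_rpow_enorm_lt_top_of_eLpNorm_lt_top hp0 hp hG.2).ne
    · filter_upwards [hlim] with x hx
      have h1 : Tendsto (fun n => ‖h n x • G x‖ₑ ^ p.toReal) atTop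
          (𝓝 (‖(0 : ℝ) • G x‖ₑ ^ p.toReal)) :=
        (ENNReal.continuous_rpow_const.tendsto _).comp
          ((hx.smul_const (G x)).enorm)
      simpa [hpr] using h1
  simp_rw [eLpNorm_eq_lintegral_rpow_enorm_toReal hp0 hp]
  have h2 := (ENNReal.continuous_rpow_const (y := 1 / p.toReal)).tendsto
    (∫⁻ _ : α, (0 : ENNReal) ∂μ) |>.comp key
  simpa [hpr, Function.comp_def] using h2

theorem sobolevExponent_pos {N : ℕ} {p : ℝ} (hp : 1 < p) (hpN : p < N) :
    0 < sobolevExponent N p := by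
  have : (0 : ℝ) < N := by linarith
  exact div_pos (by positivity) (by linarith)

/-- Pointwise convergence along a subsequence is what dominated convergence needs in the chain rule,
where the gradient error contains a bounded multiple of the fixed function `G`. -/
theorem MemBeppoLevi.exists_ae_approx {N : ℕ} {p : ℝ} {Ω : Set (EuclideanSpace ℝ (Fin N))}
    {u : EuclideanSpace ℝ (Fin N) → ℝ} {G : EuclideanSpace ℝ (Fin N) → EuclideanSpace ℝ (Fin N)}
    (hp : 1 < p) (hpN : p < N) (h : MemBeppoLevi p Ω u G) :
    ∃ φ : ℕ → EuclideanSpace ℝ (Fin N) → ℝ,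
      (∀ n, ContDiff ℝ (⊤ : ℕ∞) (φ n) ∧ HasCompactSupport (φ n) ∧ tsupport (φ n) ⊆ Ω) ∧
      Tendsto (fun n => eLpNorm (fun x => φ n x - u x)
        (ENNReal.ofReal (sobolevExponent N p)) (volume.restrict Ω)) atTop (𝓝 0) ∧
      Tendsto (fun n => eLpNorm (fun x => gradient (φ n) x - G x)
        (ENNReal.ofReal p) (volume.restrict Ω)) atTop (𝓝 0) ∧
      ∀ᵐ x ∂(volume.restrict Ω), Tendsto (fun n => φ n x) atTop (𝓝 (u x)) := by
  obtain ⟨φ, hφ, h1, h2⟩ := h.exists_approx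
  have hne : ENNReal.ofReal (sobolevExponent N p) ≠ 0 := by
    simpa using sobolevExponent_pos hp hpN
  obtain ⟨ns, hns, hae⟩ := (tendstoInMeasure_of_tendsto_eLpNorm hne
    (fun n => (hφ n).1.continuous.aestronglyMeasurable) h.memLp_fun.1 h1).exists_seq_tendsto_ae
  exact ⟨fun n => φ (ns n), fun n => hφ _, h1.comp hns.tendsto_atTop, h2.comp hns.tendsto_atTop,
    hae⟩

theorem abs_intervalIntegral_zero_sub_le {g : ℝ → ℝ} (hg : Continuous g) {L : ℝ}
    (hL : ∀ t, |g t| ≤ L) (a b : ℝ) :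
    |(∫ t in (0 : ℝ)..a, g t) - ∫ t in (0 : ℝ)..b, g t| ≤ L * |a - b| := by
  rw [intervalIntegral.integral_interval_sub_left (hg.intervalIntegrable _ _)
    (hg.intervalIntegrable _ _)]
  exact intervalIntegral.norm_integral_le_of_norm_le_const (f := g) fun t _ => hL t

theorem contDiff_intervalIntegral {g : ℝ → ℝ} (hg : ContDiff ℝ (⊤ : ℕ∞) g) :
    ContDiff ℝ (⊤ : ℕ∞) (fun a => ∫ t in (0 : ℝ)..a, g t) := by
  have hd : ∀ a, HasDerivAt (fun a => ∫ t in (0 : ℝ)..a, g t) (g a) a := fun a =>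
    intervalIntegral.integral_hasDerivAt_right (hg.continuous.intervalIntegrable _ _)
      hg.continuous.stronglyMeasurable.stronglyMeasurableAtFilter hg.continuous.continuousAt
  rw [contDiff_infty_iff_deriv]
  refine ⟨fun a => (hd a).differentiableAt, ?_⟩
  rwa [show deriv (fun a => ∫ t in (0 : ℝ)..a, g t) = g from funext fun a => (hd a).deriv]

theorem gradient_intervalIntegral_comp {E : Type*} [NormedAddCommGroup E] [InnerProductSpace ℝ E]
    [CompleteSpace E] {g : ℝ → ℝ} (hg : Continuous g) {φ : E → ℝ} (hφ : Differentiable ℝ φ)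
    (x : E) :
    gradient (fun x => ∫ t in (0 : ℝ)..φ x, g t) x = g (φ x) • gradient φ x := by
  have hd : HasDerivAt (fun a => ∫ t in (0 : ℝ)..a, g t) (g (φ x)) (φ x) :=
    intervalIntegral.integral_hasDerivAt_right (hg.intervalIntegrable _ _)
      hg.stronglyMeasurable.stronglyMeasurableAtFilter hg.continuousAt
  have h1 := hd.comp_hasFDerivAt x (hφ x).hasFDerivAt
  rw [gradient, gradient, show fderiv ℝ (fun x => ∫ t in (0 : ℝ)..φ x, g t) x
    = g (φ x) • fderiv ℝ φ x from h1.fderiv]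
  simp

/-- Chain rule in `D^{1,p}(Ω)` for a primitive, vanishing at `0`, of a bounded continuous
function. -/
theorem MemBeppoLevi.intervalIntegral_comp {N : ℕ} {p : ℝ} {Ω : Set (EuclideanSpace ℝ (Fin N))}
    {u : EuclideanSpace ℝ (Fin N) → ℝ} {G : EuclideanSpace ℝ (Fin N) → EuclideanSpace ℝ (Fin N)}
    (hp : 1 < p) (hpN : p < N) (h : MemBeppoLevi p Ω u G)
    {g : ℝ → ℝ} (hg : Continuous g) {L : ℝ} (hL : ∀ t, |g t| ≤ L) :
    MemBeppoLevi p Ω (fun x => ∫ t in (0 : ℝ)..u x, g t) (fun x => g (u x) • G x) := by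
  have hFc : Continuous (fun a => ∫ t in (0 : ℝ)..a, g t) :=
    intervalIntegral.continuous_primitive (fun _ _ => hg.intervalIntegrable _ _) 0
  have hL0 : 0 ≤ L := (abs_nonneg _).trans (hL 0)
  have hpE : ENNReal.ofReal p ≠ 0 := by simp; linarith
  have hp1 : 1 ≤ ENNReal.ofReal p := by simpa using hp.le
  have hs1 : 1 ≤ ENNReal.ofReal (sobolevExponent N p) := by
    rw [ENNReal.one_le_ofReal, sobolevExponent, le_div_iff₀ (by linarith)]
    nlinarith
  refine ⟨?_, ?_, ?_⟩
  · refine h.memLp_fun.of_le_mul (c := L) (hFc.comp_aestronglyMeasurable h.memLp_fun.1)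
      (Eventually.of_forall fun x => ?_)
    simpa using abs_intervalIntegral_zero_sub_le hg hL (u x) 0
  · refine h.memLp_grad.of_le_mul (c := L)
      ((hg.comp_aestronglyMeasurable h.memLp_fun.1).smul h.memLp_grad.1)
      (Eventually.of_forall fun x => ?_)
    rw [norm_smul]
    exact mul_le_mul_of_nonneg_right (hL _) (norm_nonneg _)
  obtain ⟨φ, hφ, h1, h2, h3⟩ := h.exists_ae_approx hp hpN
  -- The primitive of `g` is only C¹, while approximants must be smooth, so `g` is replaced by
  -- smooth functions uniformly close to it. Their primitives from `0` still vanish at `0`, which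
  -- keeps the supports inside `Ω`.
  have happ : ∀ n : ℕ, ∃ f : ℝ → ℝ, ContDiff ℝ (⊤ : ℕ∞) f ∧ ∀ t, |f t - g t| ≤ 1 / ((n : ℝ) + 1) := by
    intro n
    obtain ⟨f, hf, hfg⟩ := hg.exists_contDiff_approx (⊤ : ℕ∞) (ε := fun _ => 1 / ((n : ℝ) + 1))
      continuous_const (fun _ => by positivity)
    exact ⟨f, hf, fun t => (hfg.1 t).le⟩
  choose f hf hfg using happ
  have hfL : ∀ n t, |f n t| ≤ L + 1 := by
    intro n t
    have h4 : 1 / ((n : ℝ) + 1) ≤ 1 := by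
      rw [div_le_one (by positivity)]; simp
    have h5 := abs_add_le (f n t - g t) (g t)
    rw [sub_add_cancel] at h5
    linarith [hfg n t, hL t]
  have hlim0 : Tendsto (fun n : ℕ => ENNReal.ofReal (1 / ((n : ℝ) + 1))) atTop (𝓝 0) := by
    simpa using ENNReal.tendsto_ofReal tendsto_one_div_add_atTop_nhds_zero_nat
  refine ⟨fun n x => ∫ t in (0 : ℝ)..φ n x, f n t, fun n => ⟨?_, ?_, ?_⟩, ?_, ?_⟩
  · exact (contDiff_intervalIntegral (hf n)).comp (hφ n).1
  · exact (hφ n).2.1.comp_left (g := fun a => ∫ t in (0 : ℝ)..a, f n t) (by simp)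
  · refine (closure_mono ?_).trans (hφ n).2.2
    intro x hx hx0
    exact hx (by simp [hx0])
  · have hb : ∀ n, eLpNorm (fun x => (∫ t in (0 : ℝ)..φ n x, f n t) - ∫ t in (0 : ℝ)..u x, g t)
        (ENNReal.ofReal (sobolevExponent N p)) (volume.restrict Ω) ≤
        ENNReal.ofReal (L + 1) * eLpNorm (fun x => φ n x - u x)
        (ENNReal.ofReal (sobolevExponent N p)) (volume.restrict Ω) +
        ENNReal.ofReal (1 / ((n : ℝ) + 1)) * eLpNorm u
        (ENNReal.ofReal (sobolevExponent N p)) (volume.restrict Ω) := by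
      intro n
      have hfnc : Continuous (fun a => ∫ t in (0 : ℝ)..a, f n t) :=
        intervalIntegral.continuous_primitive
          (fun _ _ => (hf n).continuous.intervalIntegrable _ _) 0
      have e : (fun x => (∫ t in (0 : ℝ)..φ n x, f n t) - ∫ t in (0 : ℝ)..u x, g t)
          = (fun x => (∫ t in (0 : ℝ)..φ n x, f n t) - ∫ t in (0 : ℝ)..u x, f n t) +
            (fun x => (∫ t in (0 : ℝ)..u x, f n t) - ∫ t in (0 : ℝ)..u x, g t) := by
        ext x; simp
      rw [e]
      refine (eLpNorm_add_le ?_ ?_ hs1).trans (add_le_add ?_ ?_)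
      · exact (hfnc.comp_aestronglyMeasurable (hφ n).1.continuous.aestronglyMeasurable).sub
          (hfnc.comp_aestronglyMeasurable h.memLp_fun.1)
      · exact (hfnc.comp_aestronglyMeasurable h.memLp_fun.1).sub
          (hFc.comp_aestronglyMeasurable h.memLp_fun.1)
      · exact eLpNorm_le_mul_eLpNorm_of_ae_le_mul (Eventually.of_forall fun x =>
          abs_intervalIntegral_zero_sub_le (hf n).continuous (hfL n) _ _) _
      · refine eLpNorm_le_mul_eLpNorm_of_ae_le_mul (Eventually.of_forall fun x => ?_) _
        rw [← intervalIntegral.integral_sub ((hf n).continuous.intervalIntegrable _ _)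
          (hg.intervalIntegrable _ _)]
        simpa using intervalIntegral.norm_integral_le_of_norm_le_const (a := 0) (b := u x)
          (f := fun t => f n t - g t) fun t _ => hfg n t
    refine tendsto_of_tendsto_of_tendsto_of_le_of_le tendsto_const_nhds ?_ (fun _ => zero_le) hb
    have := (ENNReal.Tendsto.const_mul h1 (a := ENNReal.ofReal (L + 1)) (Or.inr (by simp))).add
      (ENNReal.Tendsto.mul_const hlim0 (b := eLpNorm u
        (ENNReal.ofReal (sobolevExponent N p)) (volume.restrict Ω))
        (Or.inr h.memLp_fun.2.ne))
    simpa using this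
  · have hb : ∀ n, eLpNorm (fun x => gradient (fun x => ∫ t in (0 : ℝ)..φ n x, f n t) x
          - g (u x) • G x) (ENNReal.ofReal p) (volume.restrict Ω) ≤
        ENNReal.ofReal (L + 1) * eLpNorm (fun x => gradient (φ n) x - G x)
        (ENNReal.ofReal p) (volume.restrict Ω) +
        eLpNorm (fun x => (f n (φ n x) - g (u x)) • G x)
        (ENNReal.ofReal p) (volume.restrict Ω) := by
      intro n
      have hgm : AEStronglyMeasurable (gradient (φ n)) (volume.restrict Ω) := by
        refine Continuous.aestronglyMeasurable ?_
        exact (InnerProductSpace.toDual ℝ _).symm.continuous.comp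
          ((hφ n).1.continuous_fderiv (by simp))
      have hfm : AEStronglyMeasurable (fun x => f n (φ n x)) (volume.restrict Ω) :=
        ((hf n).continuous.comp (hφ n).1.continuous).aestronglyMeasurable
      have e : (fun x => gradient (fun x => ∫ t in (0 : ℝ)..φ n x, f n t) x - g (u x) • G x)
          = (fun x => f n (φ n x) • (gradient (φ n) x - G x)) +
            (fun x => (f n (φ n x) - g (u x)) • G x) := by
        ext1 x
        rw [gradient_intervalIntegral_comp (hf n).continuous ((hφ n).1.differentiable (by simp))]
        simp only [Pi.add_apply, smul_sub, sub_smul]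
        abel
      rw [e]
      refine (eLpNorm_add_le ?_ ?_ hp1).trans (add_le_add ?_ le_rfl)
      · exact hfm.smul (hgm.sub h.memLp_grad.1)
      · exact (hfm.sub (hg.comp_aestronglyMeasurable h.memLp_fun.1)).smul h.memLp_grad.1
      · refine eLpNorm_le_mul_eLpNorm_of_ae_le_mul (Eventually.of_forall fun x => ?_) _
        rw [norm_smul]
        exact mul_le_mul_of_nonneg_right (hfL n _) (norm_nonneg _)
    refine tendsto_of_tendsto_of_tendsto_of_le_of_le tendsto_const_nhds ?_ (fun _ => zero_le) hb
    have hz : Tendsto (fun n => eLpNorm (fun x => (f n (φ n x) - g (u x)) • G x)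
        (ENNReal.ofReal p) (volume.restrict Ω)) atTop (𝓝 0) := by
      refine tendsto_eLpNorm_bounded_smul (K := L + 1 + L) hpE ENNReal.ofReal_ne_top ?_ ?_ ?_
        h.memLp_grad
      · intro n
        exact ((hf n).continuous.comp (hφ n).1.continuous).aestronglyMeasurable.sub
          (hg.comp_aestronglyMeasurable h.memLp_fun.1)
      · intro n x
        exact (abs_sub _ _).trans (add_le_add (hfL n _) (hL _))
      · filter_upwards [h3] with x hx
        have h4 : Tendsto (fun n => (f n (φ n x) - g (φ n x)) + (g (φ n x) - g (u x))) atTop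
            (𝓝 (0 + (g (u x) - g (u x)))) := by
          refine Tendsto.add ?_ (((hg.tendsto _).comp hx).sub_const _)
          exact squeeze_zero_norm (fun n => hfg n _) tendsto_one_div_add_atTop_nhds_zero_nat
        simpa using h4
    have := (ENNReal.Tendsto.const_mul h2 (a := ENNReal.ofReal (L + 1)) (Or.inr (by simp))).add hz
    simpa using this

/-! ### Sobolev's inequality for the completion. -/

/-- Sobolev's inequality in `D^{1,p}(Ω)`. -/
theorem exists_sobolev_constant (N : ℕ) {p : ℝ} (hp : 1 < p) (hpN : p < N) :
    ∃ S : ℝ, 0 < S ∧ ∀ (Ω : Set (EuclideanSpace ℝ (Fin N))) (u : EuclideanSpace ℝ (Fin N) → ℝ)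
      (G : EuclideanSpace ℝ (Fin N) → EuclideanSpace ℝ (Fin N)), MemBeppoLevi p Ω u G →
      eLpNorm u (ENNReal.ofReal (sobolevExponent N p)) (volume.restrict Ω) ≤
        ENNReal.ofReal S * eLpNorm G (ENNReal.ofReal p) (volume.restrict Ω) := by
  have hs := sobolevExponent_pos hp hpN
  have hs1 : 1 ≤ ENNReal.ofReal (sobolevExponent N p) := by
    rw [ENNReal.one_le_ofReal, sobolevExponent, le_div_iff₀ (by linarith)]
    nlinarith
  have hp1 : 1 ≤ ENNReal.ofReal p := by simpa using hp.le
  set C : NNReal := SNormLESNormFDerivOfEqConst ℝ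
    (volume : Measure (EuclideanSpace ℝ (Fin N))) (p.toNNReal : ℝ) with hC
  refine ⟨C + 1, by positivity, fun Ω u G h => ?_⟩
  obtain ⟨φ, hφ, h1, h2⟩ := h.exists_approx
  have hgm : ∀ n, AEStronglyMeasurable (gradient (φ n)) (volume.restrict Ω) := fun n =>
    Continuous.aestronglyMeasurable ((InnerProductSpace.toDual ℝ _).symm.continuous.comp
      ((hφ n).1.continuous_fderiv (by simp)))
  -- A test function and its gradient vanish off `Ω`, so the inequality on the whole space applies
  -- and the constant does not depend on `Ω`.
  have hφs : ∀ n, eLpNorm (φ n) (ENNReal.ofReal (sobolevExponent N p)) (volume.restrict Ω) ≤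
      ENNReal.ofReal (C + 1) *
        eLpNorm (gradient (φ n)) (ENNReal.ofReal p) (volume.restrict Ω) := by
    intro n
    have hsup : Function.support (gradient (φ n)) ⊆ Ω := by
      refine subset_trans ?_ ((support_fderiv_subset ℝ).trans (hφ n).2.2)
      intro x hx hx0
      exact hx (by simp [gradient, hx0])
    have hN : (0 : ℝ) < N := by linarith
    have key := eLpNorm_le_eLpNorm_fderiv_of_eq
      (volume : Measure (EuclideanSpace ℝ (Fin N))) (u := φ n)
      ((hφ n).1.of_le (by simp)) (hφ n).2.1 (p := p.toNNReal)
      (p' := (sobolevExponent N p).toNNReal)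
      (by simpa using hp.le) (by simpa using Nat.pos_of_ne_zero (by rintro rfl; simp at hN))
      (by
        have h3 : (N : ℝ) - p ≠ 0 := by linarith
        have h4 : p ≠ 0 := by linarith
        rw [Real.coe_toNNReal _ hs.le, NNReal.coe_inv, Real.coe_toNNReal _ (by linarith),
          sobolevExponent]
        simp only [finrank_euclideanSpace, Fintype.card_fin]
        field_simp)
    have hgf : eLpNorm (gradient (φ n)) (ENNReal.ofReal p) volume =
        eLpNorm (fderiv ℝ (φ n)) (ENNReal.ofReal p) volume :=
      eLpNorm_congr_norm_ae (Eventually.of_forall fun x => by simp [gradient])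
    rw [eLpNorm_restrict_eq_of_support_subset hsup, hgf]
    refine (eLpNorm_mono_measure _ Measure.restrict_le_self).trans (key.trans ?_)
    refine mul_le_mul' ?_ le_rfl
    rw [← hC, ← ENNReal.ofReal_coe_nnreal]
    exact ENNReal.ofReal_le_ofReal (by linarith)
  have hb : ∀ n, eLpNorm u (ENNReal.ofReal (sobolevExponent N p)) (volume.restrict Ω) ≤
      eLpNorm (fun x => φ n x - u x) (ENNReal.ofReal (sobolevExponent N p)) (volume.restrict Ω) +
      ENNReal.ofReal (C + 1) * (eLpNorm (fun x => gradient (φ n) x - G x) (ENNReal.ofReal p)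
        (volume.restrict Ω) + eLpNorm G (ENNReal.ofReal p) (volume.restrict Ω)) := by
    intro n
    have e1 : u = φ n - (fun x => φ n x - u x) := by ext x; simp
    have e2 : gradient (φ n) = (fun x => gradient (φ n) x - G x) + G := by ext1 x; simp
    have hφm : AEStronglyMeasurable (φ n) (volume.restrict Ω) :=
      (hφ n).1.continuous.aestronglyMeasurable
    calc eLpNorm u (ENNReal.ofReal (sobolevExponent N p)) (volume.restrict Ω)
        = eLpNorm (φ n - (fun x => φ n x - u x)) (ENNReal.ofReal (sobolevExponent N p))
          (volume.restrict Ω) := by rw [← e1]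
      _ ≤ eLpNorm (φ n) (ENNReal.ofReal (sobolevExponent N p)) (volume.restrict Ω) +
          eLpNorm (fun x => φ n x - u x) (ENNReal.ofReal (sobolevExponent N p))
            (volume.restrict Ω) :=
        eLpNorm_sub_le hφm (hφm.sub h.memLp_fun.1) hs1
      _ ≤ _ := by
        rw [add_comm]
        refine add_le_add le_rfl ((hφs n).trans (mul_le_mul' le_rfl ?_))
        conv_lhs => rw [e2]
        exact eLpNorm_add_le ((hgm n).sub h.memLp_grad.1) h.memLp_grad.1 hp1
  have hlim := h1.add (ENNReal.Tendsto.const_mul (h2.add_const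
    (eLpNorm G (ENNReal.ofReal p) (volume.restrict Ω))) (a := ENNReal.ofReal (C + 1))
    (Or.inr ENNReal.ofReal_ne_top))
  simpa using ge_of_tendsto' hlim hb

/-! ### Truncated powers and their primitives. -/

/-- The truncated power `t ↦ min(|t|, k)^a`. -/
noncomputable def truncPow (k a t : ℝ) : ℝ := min |t| k ^ a

section TruncPow

variable {k a : ℝ}

theorem truncPow_nonneg (hk : 0 < k) (t : ℝ) : 0 ≤ truncPow k a t :=
  Real.rpow_nonneg (le_min (abs_nonneg t) hk.le) a

theorem continuous_truncPow (ha : 0 ≤ a) : Continuous (truncPow k a) :=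
  (continuous_abs.min continuous_const).rpow_const fun _ => Or.inr ha

theorem truncPow_le_const (hk : 0 < k) (ha : 0 ≤ a) (t : ℝ) : truncPow k a t ≤ k ^ a :=
  Real.rpow_le_rpow (le_min (abs_nonneg t) hk.le) (min_le_right _ _) ha

theorem truncPow_le_rpow (hk : 0 < k) (ha : 0 ≤ a) (t : ℝ) : truncPow k a t ≤ |t| ^ a :=
  Real.rpow_le_rpow (le_min (abs_nonneg t) hk.le) (min_le_left _ _) ha

theorem truncPow_mono (hk : 0 < k) (ha : 0 ≤ a) {s t : ℝ} (h : |s| ≤ |t|) :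
    truncPow k a s ≤ truncPow k a t :=
  Real.rpow_le_rpow (le_min (abs_nonneg s) hk.le) (min_le_min_right _ h) ha

theorem truncPow_rpow (hk : 0 < k) (b t : ℝ) : truncPow k a t ^ b = truncPow k (a * b) t :=
  (Real.rpow_mul (le_min (abs_nonneg t) hk.le) a b).symm

/-- The integrand is nondecreasing in `|x|`, so on the interval between `0` and `t` it is at most
its value at `t`. -/
theorem abs_integral_truncPow_le (hk : 0 < k) (ha : 0 ≤ a) (t : ℝ) :
    |∫ x in (0 : ℝ)..t, truncPow k a x| ≤ |t| * truncPow k a t := by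
  have h := intervalIntegral.norm_integral_le_of_norm_le_const (f := truncPow k a)
    (a := 0) (b := t) (C := truncPow k a t) fun x hx => by
      rw [Real.norm_of_nonneg (truncPow_nonneg hk x)]
      refine truncPow_mono hk ha ?_
      rcases le_total 0 t with ht | ht
      · rw [Set.uIoc_of_le ht] at hx
        rw [abs_of_nonneg ht, abs_of_pos hx.1]; exact hx.2
      · rw [Set.uIoc_of_ge ht] at hx
        rw [abs_of_nonpos ht, abs_of_nonpos hx.2]; linarith [hx.1]
  rw [sub_zero, mul_comm] at h
  exact h

/-- Up to `k` both sides equal `t^(a+1)`. Beyond `k` the left side grows with slope `k^a` and the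
right side with slope `(a+1) k^a`. -/
theorem mul_truncPow_le_integral_of_nonneg (hk : 0 < k) (ha : 0 < a) {t : ℝ} (ht : 0 ≤ t) :
    t * truncPow k a t ≤ (a + 1) * ∫ x in (0 : ℝ)..t, truncPow k a x := by
  have hpow : ∀ r, 0 ≤ r → r ≤ k →
      ∫ x in (0 : ℝ)..r, truncPow k a x = r ^ (a + 1) / (a + 1) := by
    intro r hr hrk
    have e : ∫ x in (0 : ℝ)..r, truncPow k a x = ∫ x in (0 : ℝ)..r, x ^ a := by
      refine intervalIntegral.integral_congr fun x hx => ?_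
      rw [Set.uIcc_of_le hr] at hx
      simp only [truncPow]
      rw [abs_of_nonneg hx.1, min_eq_left (hx.2.trans hrk)]
    rw [e, integral_rpow (Or.inl (by linarith)), Real.zero_rpow (by linarith), sub_zero]
  rcases le_total t k with h | h
  · rw [hpow t ht h, mul_div_cancel₀ _ (by linarith : a + 1 ≠ 0), truncPow, abs_of_nonneg ht,
      min_eq_left h, Real.rpow_add_one' ht (by linarith), mul_comm]
  · have e : ∫ x in k..t, truncPow k a x = (t - k) * k ^ a := by
      have : ∫ x in k..t, truncPow k a x = ∫ _ in k..t, k ^ a := by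
        refine intervalIntegral.integral_congr fun x hx => ?_
        rw [Set.uIcc_of_le h] at hx
        simp only [truncPow]
        rw [abs_of_nonneg (hk.le.trans hx.1), min_eq_right hx.1]
      rw [this, intervalIntegral.integral_const, smul_eq_mul]
    have hi : ∀ c d, IntervalIntegrable (truncPow k a) volume c d := fun c d =>
      (continuous_truncPow ha.le).intervalIntegrable c d
    rw [← intervalIntegral.integral_add_adjacent_intervals (hi 0 k) (hi k t),
      hpow k hk.le le_rfl, e, truncPow, abs_of_nonneg ht, min_eq_right h,
      Real.rpow_add_one' hk.le (by linarith)]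
    have h1 : 0 ≤ a * ((t - k) * k ^ a) :=
      mul_nonneg ha.le (mul_nonneg (by linarith) (Real.rpow_nonneg hk.le a))
    have h2 : (a + 1) * (k ^ a * k / (a + 1) + (t - k) * k ^ a)
        = k ^ a * k + (a + 1) * ((t - k) * k ^ a) := by field_simp
    rw [h2]
    nlinarith

theorem abs_mul_truncPow_le_integral (hk : 0 < k) (ha : 0 < a) (t : ℝ) :
    |t| * truncPow k a t ≤ (a + 1) * |∫ x in (0 : ℝ)..t, truncPow k a x| := by
  have hle : ∀ r, 0 ≤ r → r * truncPow k a r ≤ (a + 1) * |∫ x in (0 : ℝ)..r, truncPow k a x| :=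
    fun r hr => (mul_truncPow_le_integral_of_nonneg hk ha hr).trans
      (mul_le_mul_of_nonneg_left (le_abs_self _) (by linarith))
  rcases le_total 0 t with ht | ht
  · rw [abs_of_nonneg ht]; exact hle t ht
  · have h := hle (-t) (by linarith)
    have e : ∫ x in (0 : ℝ)..-t, truncPow k a x = -∫ x in (0 : ℝ)..t, truncPow k a x := by
      have h1 := intervalIntegral.integral_comp_neg (a := 0) (b := t) (f := truncPow k a)
      rw [neg_zero, intervalIntegral.integral_symm 0 (-t)] at h1
      rw [← neg_eq_iff_eq_neg, ← h1]
      exact intervalIntegral.integral_congr fun x _ => by simp [truncPow]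
    rw [e, abs_neg] at h
    rw [abs_of_nonpos ht]
    simpa [truncPow] using h

end TruncPow

/-! ### The energy estimate. -/

/-- Young's inequality by cases: if `b Y ≤ (lam/2) X` the first term suffices, and otherwise `X ≤
(2/lam) b Y` can be substituted into `X^(p-1)`. -/
theorem mul_rpow_sub_one_mul_le {p lam b X Y : ℝ} (hp : 1 < p) (hlam : 0 < lam) (hb : 0 ≤ b)
    (hX : 0 ≤ X) (hY : 0 ≤ Y) :
    b * X ^ (p - 1) * Y ≤ lam / 2 * X ^ p + (2 / lam) ^ (p - 1) * b ^ p * Y ^ p := by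
  have e : ∀ x : ℝ, 0 ≤ x → x ^ (p - 1) * x = x ^ p := fun x hx => by
    rw [← Real.rpow_add_one' hx (by linarith), sub_add_cancel]
  have h1 : 0 ≤ (2 / lam) ^ (p - 1) * b ^ p * Y ^ p := by positivity
  have h2 : 0 ≤ lam / 2 * X ^ p := by positivity
  rcases le_total (b * Y) (lam / 2 * X) with h | h
  · have h3 : b * X ^ (p - 1) * Y ≤ lam / 2 * X ^ p := by
      rw [← e X hX]
      nlinarith [Real.rpow_nonneg hX (p - 1)]
    linarith
  · have h3 : X ≤ 2 / lam * (b * Y) := by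
      rw [div_mul_eq_mul_div, le_div_iff₀ hlam]; linarith
    have h4 : X ^ (p - 1) ≤ (2 / lam) ^ (p - 1) * (b * Y) ^ (p - 1) := by
      rw [← Real.mul_rpow (by positivity) (by positivity)]
      exact Real.rpow_le_rpow hX h3 (by linarith)
    have h5 : b * X ^ (p - 1) * Y ≤ (2 / lam) ^ (p - 1) * b ^ p * Y ^ p := by
      calc b * X ^ (p - 1) * Y = X ^ (p - 1) * (b * Y) := by ring
        _ ≤ (2 / lam) ^ (p - 1) * (b * Y) ^ (p - 1) * (b * Y) := by gcongr
        _ = _ := by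
          rw [mul_assoc, e _ (by positivity), Real.mul_rpow hb hY, mul_assoc]
    linarith

/-- Energy estimate obtained by testing the equation with a primitive of `g` along `u`. -/
theorem IsWeakSolution.energy_le {N : ℕ} {p lam β₁ : ℝ} (hp : 1 < p) (hpN : p < N)
    (hlam : 0 < lam) {Ω : Set (EuclideanSpace ℝ (Fin N))}
    {A : EuclideanSpace ℝ (Fin N) → ℝ → EuclideanSpace ℝ (Fin N) → EuclideanSpace ℝ (Fin N)}
    {B : EuclideanSpace ℝ (Fin N) → ℝ → EuclideanSpace ℝ (Fin N) → ℝ}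
    {a₁ a₂ b₁ b₂ b₃ : EuclideanSpace ℝ (Fin N) → ℝ}
    (hnn : ∀ᵐ x ∂(volume.restrict Ω),
      0 ≤ a₁ x ∧ 0 ≤ a₂ x ∧ 0 ≤ b₁ x ∧ 0 ≤ b₂ x ∧ 0 ≤ b₃ x)
    (hA : StructureA p lam Ω A a₁ a₂) (hB : StructureB p Ω B b₁ b₂ b₃)
    (hb₁ : ∀ᵐ x ∂(volume.restrict Ω), b₁ x ≤ β₁)
    {u : EuclideanSpace ℝ (Fin N) → ℝ} {G : EuclideanSpace ℝ (Fin N) → EuclideanSpace ℝ (Fin N)}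
    (hu : IsWeakSolution p Ω A B u G) {g : ℝ → ℝ} (hg : Continuous g) {L : ℝ}
    (hg0 : ∀ t, 0 ≤ g t) (hgL : ∀ t, g t ≤ L)
    (hgF : ∀ t, |∫ x in (0 : ℝ)..t, g x| ≤ |t| * g t)
    (hR : Integrable (fun x => ((a₁ x + b₂ x + (2 / lam) ^ (p - 1) * β₁ ^ p) * |u x| ^ p + a₂ x +
      b₃ x * |u x|) * g (u x)) (volume.restrict Ω)) :
    lam / 2 * ∫ x in Ω, g (u x) * ‖G x‖ ^ p ≤
      ∫ x in Ω, ((a₁ x + b₂ x + (2 / lam) ^ (p - 1) * β₁ ^ p) * |u x| ^ p + a₂ x +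
        b₃ x * |u x|) * g (u x) := by
  have hφ := hu.mem.intervalIntegral_comp hp hpN hg
    (fun t => (abs_of_nonneg (hg0 t)).trans_le (hgL t))
  obtain ⟨h1, h2, h3⟩ := hu.weak_eq _ _ hφ
  have hGp : Integrable (fun x => ‖G x‖ ^ p) (volume.restrict Ω) := by
    have := hu.mem.memLp_grad.integrable_norm_rpow (by simp; linarith) ENNReal.ofReal_ne_top
    rwa [ENNReal.toReal_ofReal (by linarith)] at this
  have hgG : Integrable (fun x => g (u x) * ‖G x‖ ^ p) (volume.restrict Ω) := by
    refine hGp.bdd_mul (c := L) (hg.comp_aestronglyMeasurable hu.mem.memLp_fun.1)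
      (Eventually.of_forall fun x => ?_)
    rw [Real.norm_of_nonneg (hg0 _)]; exact hgL _
  -- Half of the coercive term absorbs the `b₁` term by Young. The bracket on the right is the
  -- integrand of the weak equation for this test function, so its integral is zero.
  have hle : ∀ᵐ x ∂(volume.restrict Ω), lam / 2 * (g (u x) * ‖G x‖ ^ p) ≤
      (inner ℝ (A x (u x) (G x)) (g (u x) • G x) -
        B x (u x) (G x) * ∫ t in (0 : ℝ)..u x, g t) +
      ((a₁ x + b₂ x + (2 / lam) ^ (p - 1) * β₁ ^ p) * |u x| ^ p + a₂ x +
        b₃ x * |u x|) * g (u x) := by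
    filter_upwards [hnn, hA, hB, hb₁] with x hx hAx hBx hbx
    obtain ⟨ha1, ha2, hb1, hb2, hb3⟩ := hx
    have hAx := hAx (u x) (G x)
    have hBx := hBx (u x) (G x)
    have hgx := hg0 (u x)
    have hFx := hgF (u x)
    set F := ∫ t in (0 : ℝ)..u x, g t
    set X := ‖G x‖
    have hX : 0 ≤ X := norm_nonneg _
    set Y := |u x|
    have hY : 0 ≤ Y := abs_nonneg _
    set γ := g (u x)
    have hBF : B x (u x) (G x) * F ≤
        (b₁ x * X ^ (p - 1) + b₂ x * Y ^ (p - 1) + b₃ x) * (Y * γ) := by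
      calc B x (u x) (G x) * F ≤ |B x (u x) (G x) * F| := le_abs_self _
        _ = |B x (u x) (G x)| * |F| := abs_mul _ _
        _ ≤ _ := by gcongr
    have hyoung := mul_rpow_sub_one_mul_le hp hlam hb1 hX hY
    have hbp : b₁ x ^ p ≤ β₁ ^ p := Real.rpow_le_rpow hb1 hbx (by linarith)
    have hc : (2 / lam) ^ (p - 1) * b₁ x ^ p * Y ^ p ≤
        (2 / lam) ^ (p - 1) * β₁ ^ p * Y ^ p := by gcongr
    have hYp : Y ^ (p - 1) * Y = Y ^ p := by
      rw [← Real.rpow_add_one' hY (by linarith), sub_add_cancel]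
    rw [inner_smul_right]
    have hAg := mul_le_mul_of_nonneg_left hAx hgx
    have hyg := mul_le_mul_of_nonneg_left (hyoung.trans (add_le_add le_rfl hc)) hgx
    have e : (b₁ x * X ^ (p - 1) + b₂ x * Y ^ (p - 1) + b₃ x) * (Y * γ) =
        γ * (b₁ x * X ^ (p - 1) * Y) + γ * b₂ x * Y ^ p + γ * b₃ x * Y := by
      rw [← hYp]; ring
    rw [e] at hBF
    nlinarith
  have hint := integral_mono_ae (hgG.const_mul (lam / 2)) ((h1.sub h2).add hR) hle
  rw [integral_const_mul, integral_add' (h1.sub h2) hR, integral_sub' h1 h2, h3, sub_self,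
    zero_add] at hint
  exact hint

/-! ### Hölder, interpolation and Fatou for integrals of real powers. -/

section RealPowerIntegrals

variable {α : Type*} [MeasurableSpace α] {μ : Measure α}

theorem memLp_ofReal_iff_integrable_abs_rpow {f : α → ℝ} (hf : AEStronglyMeasurable f μ) {r : ℝ}
    (hr : 0 < r) : MemLp f (ENNReal.ofReal r) μ ↔ Integrable (fun x => |f x| ^ r) μ := by
  rw [← integrable_norm_rpow_iff hf (by simpa using hr) ENNReal.ofReal_ne_top,
    ENNReal.toReal_ofReal hr.le]
  rfl

theorem lpNorm_ofReal_eq {f : α → ℝ} (hf : AEStronglyMeasurable f μ) {r : ℝ} (hr : 0 < r) :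
    lpNorm f (ENNReal.ofReal r) μ = (∫ x, |f x| ^ r ∂μ) ^ (1 / r) := by
  rw [lpNorm_eq_integral_norm_rpow_toReal (by simpa using hr) ENNReal.ofReal_ne_top hf,
    ENNReal.toReal_ofReal hr.le, one_div]
  rfl

theorem integral_abs_rpow_nonneg (f : α → ℝ) (r : ℝ) : 0 ≤ ∫ x, |f x| ^ r ∂μ :=
  integral_nonneg fun _ => Real.rpow_nonneg (abs_nonneg _) _

theorem lpNorm_ofReal_rpow {f : α → ℝ} (hf : AEStronglyMeasurable f μ) {r : ℝ} (hr : 0 < r) :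
    lpNorm f (ENNReal.ofReal r) μ ^ r = ∫ x, |f x| ^ r ∂μ := by
  rw [lpNorm_ofReal_eq hf hr, ← Real.rpow_mul (integral_abs_rpow_nonneg f r),
    one_div_mul_cancel hr.ne', Real.rpow_one]

theorem memLp_abs_rpow {f : α → ℝ} (hf : AEStronglyMeasurable f μ) {a r : ℝ} (hr : 0 < r)
    (h : Integrable (fun x => |f x| ^ (a * r)) μ) :
    MemLp (fun x => |f x| ^ a) (ENNReal.ofReal r) μ := by
  have hm : AEStronglyMeasurable (fun x => |f x| ^ a) μ :=
    (hf.norm.aemeasurable.pow_const a).aestronglyMeasurable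
  rw [memLp_ofReal_iff_integrable_abs_rpow hm hr]
  refine h.congr (Eventually.of_forall fun x => ?_)
  simp only
  rw [abs_of_nonneg (Real.rpow_nonneg (abs_nonneg _) _), Real.rpow_mul (abs_nonneg _)]

/-- Hölder's inequality for powers of absolute values. -/
theorem integrable_and_integral_abs_rpow_mul_le {f g : α → ℝ} (hf : AEStronglyMeasurable f μ)
    (hg : AEStronglyMeasurable g μ) {a b r r' : ℝ} (hr : r.HolderConjugate r')
    (hfi : Integrable (fun x => |f x| ^ (a * r)) μ)
    (hgi : Integrable (fun x => |g x| ^ (b * r')) μ) :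
    Integrable (fun x => |f x| ^ a * |g x| ^ b) μ ∧
      ∫ x, |f x| ^ a * |g x| ^ b ∂μ ≤
        (∫ x, |f x| ^ (a * r) ∂μ) ^ (1 / r) * (∫ x, |g x| ^ (b * r') ∂μ) ^ (1 / r') := by
  have h1 := memLp_abs_rpow hf hr.pos hfi
  have h2 := memLp_abs_rpow hg hr.symm.pos hgi
  have : ENNReal.HolderConjugate (ENNReal.ofReal r) (ENNReal.ofReal r') := hr.ennrealOfReal
  refine ⟨h1.integrable_mul h2, ?_⟩
  refine (integral_mul_le_Lp_mul_Lq_of_nonneg hr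
    (Eventually.of_forall fun x => Real.rpow_nonneg (abs_nonneg _) _)
    (Eventually.of_forall fun x => Real.rpow_nonneg (abs_nonneg _) _) h1 h2).trans_eq ?_
  simp_rw [Real.rpow_mul (abs_nonneg _)]

/-- A function in `L^{r₀} ∩ L^∞` is in `L^r` for `r ≥ r₀`, with norm at most `|f|_{r₀} + |f|_∞`. -/
theorem integrable_and_integral_abs_rpow_le_add {f : α → ℝ} {r₀ r : ℝ} (hr₀ : 0 < r₀)
    (hr : r₀ ≤ r) (hf : MemLp f (ENNReal.ofReal r₀) μ) (hf' : MemLp f ⊤ μ) :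
    Integrable (fun x => |f x| ^ r) μ ∧
      ∫ x, |f x| ^ r ∂μ ≤ (lpNorm f (ENNReal.ofReal r₀) μ + lpNorm f ⊤ μ) ^ r := by
  set T₀ := lpNorm f (ENNReal.ofReal r₀) μ with hT₀
  set T := lpNorm f ⊤ μ with hT
  have hT₀0 : 0 ≤ T₀ := lpNorm_nonneg
  have hT0 : 0 ≤ T := lpNorm_nonneg
  have hi := (memLp_ofReal_iff_integrable_abs_rpow hf.1 hr₀).1 hf
  have hle : ∀ᵐ x ∂μ, |f x| ^ r ≤ T ^ (r - r₀) * |f x| ^ r₀ := by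
    filter_upwards [ae_le_lpNorm_exponent_top hf'] with x hx
    calc |f x| ^ r = |f x| ^ ((r - r₀) + r₀) := by rw [sub_add_cancel]
      _ = |f x| ^ (r - r₀) * |f x| ^ r₀ :=
        Real.rpow_add_of_nonneg (abs_nonneg _) (by linarith) hr₀.le
      _ ≤ _ := by
        gcongr
        exact hx
  have hint : Integrable (fun x => |f x| ^ r) μ := by
    refine (hi.const_mul (T ^ (r - r₀))).mono'
      (hf.1.norm.aemeasurable.pow_const r).aestronglyMeasurable ?_
    filter_upwards [hle] with x hx
    rwa [Real.norm_of_nonneg (Real.rpow_nonneg (abs_nonneg _) _)]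
  refine ⟨hint, (integral_mono_ae hint (hi.const_mul _) hle).trans ?_⟩
  rw [integral_const_mul, ← lpNorm_ofReal_rpow hf.1 hr₀, ← hT₀]
  calc T ^ (r - r₀) * T₀ ^ r₀ ≤ (T₀ + T) ^ (r - r₀) * (T₀ + T) ^ r₀ := by
        gcongr <;> linarith
    _ = (T₀ + T) ^ r := by
        rw [← Real.rpow_add_of_nonneg (by positivity) (by linarith) hr₀.le, sub_add_cancel]

/-- Estimate of a source term `∫ f |u|^{s-σ}` with `f ∈ L^{β/σ} ∩ L^∞` and `s ≥ β`. -/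
theorem integrable_and_integral_mul_rpow_sub_le {f u : α → ℝ} {σ β s : ℝ} (hσ : 0 < σ)
    (hσβ : σ < β) (hs : β ≤ s) (hf0 : ∀ᵐ x ∂μ, 0 ≤ f x)
    (hf : MemLp f (ENNReal.ofReal (β / σ)) μ) (hf' : MemLp f ⊤ μ)
    (hu : AEStronglyMeasurable u μ) (hui : Integrable (fun x => |u x| ^ s) μ) :
    Integrable (fun x => f x * |u x| ^ (s - σ)) μ ∧
      ∫ x, f x * |u x| ^ (s - σ) ∂μ ≤
        (lpNorm f (ENNReal.ofReal (β / σ)) μ + lpNorm f ⊤ μ) *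
          (∫ x, |u x| ^ s ∂μ) ^ ((s - σ) / s) := by
  have hs0 : 0 < s := by linarith
  have hsσ : 0 < s - σ := by linarith
  -- Since `s / σ ≥ β / σ`, the norm of `f` in `L^{s/σ}` is at most the sum of its two given norms.
  -- The bound is uniform in `s` and can be reused at every stage of the iteration.
  have hconj : (s / σ).HolderConjugate (s / (s - σ)) := by
    rw [Real.holderConjugate_iff]
    constructor
    · rw [lt_div_iff₀ hσ]; linarith
    · field_simp; ring
  obtain ⟨h1, h2⟩ := integrable_and_integral_abs_rpow_le_add (r := s / σ)
    (div_pos (by linarith) hσ) (by gcongr) hf hf'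
  have e1 : 1 * (s / σ) = s / σ := one_mul _
  have e2 : (s - σ) * (s / (s - σ)) = s := by field_simp
  obtain ⟨h3, h4⟩ := integrable_and_integral_abs_rpow_mul_le (a := 1) (b := s - σ) hf.1 hu hconj
    (by rwa [e1]) (by rwa [e2])
  rw [e1, e2] at h4
  have hae : ∀ᵐ x ∂μ, |f x| ^ (1 : ℝ) * |u x| ^ (s - σ) = f x * |u x| ^ (s - σ) := by
    filter_upwards [hf0] with x hx
    rw [Real.rpow_one, abs_of_nonneg hx]
  refine ⟨h3.congr hae, ?_⟩
  rw [← integral_congr_ae hae]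
  have hT : 0 ≤ lpNorm f (ENNReal.ofReal (β / σ)) μ + lpNorm f ⊤ μ :=
    add_nonneg lpNorm_nonneg lpNorm_nonneg
  refine h4.trans ?_
  rw [show 1 / (s / (s - σ)) = (s - σ) / s by field_simp]
  refine mul_le_mul_of_nonneg_right ?_ (Real.rpow_nonneg (integral_abs_rpow_nonneg u s) _)
  calc (∫ x, |f x| ^ (s / σ) ∂μ) ^ (1 / (s / σ))
      ≤ ((lpNorm f (ENNReal.ofReal (β / σ)) μ + lpNorm f ⊤ μ) ^ (s / σ)) ^ (1 / (s / σ)) :=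
        Real.rpow_le_rpow (integral_abs_rpow_nonneg f _) h2 (by positivity)
    _ = _ := by
        rw [← Real.rpow_mul hT, mul_one_div_cancel (by positivity), Real.rpow_one]

/-- Pointwise substitute for splitting the domain into `{d ≤ h}` and `{d > h}`. For `κ > 1` the
factor `h^(1-κ)` is small when `h` is large. -/
theorem le_add_rpow_mul_rpow {d h κ : ℝ} (hd : 0 ≤ d) (hh : 0 < h) (hκ : 1 ≤ κ) :
    d ≤ h + h ^ (1 - κ) * d ^ κ := by
  rcases le_total d h with h1 | h1
  · have : 0 ≤ h ^ (1 - κ) * d ^ κ := by positivity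
    linarith
  · have hd0 : 0 < d := hh.trans_le h1
    have h2 : d ^ (1 - κ) ≤ h ^ (1 - κ) :=
      Real.rpow_le_rpow_of_nonpos hh h1 (by linarith)
    have h3 : d = d ^ (1 - κ) * d ^ κ := by
      rw [← Real.rpow_add hd0, sub_add_cancel, Real.rpow_one]
    have h4 : d ^ (1 - κ) * d ^ κ ≤ h ^ (1 - κ) * d ^ κ := by gcongr
    linarith

/-- Subcritical potentials: `∫ d |W|^p` is controlled by `∫ |W|^p` and a small multiple of the
critical norm. -/
theorem integrable_and_integral_potential_le {d W : α → ℝ} {p q n h : ℝ} (hp : 0 < p)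
    (hpn : p < n) (hq : n < q) (hh : 0 < h) (hd0 : ∀ᵐ x ∂μ, 0 ≤ d x)
    (hd : MemLp d (ENNReal.ofReal (q / p)) μ) (hW : AEStronglyMeasurable W μ)
    (hWp : Integrable (fun x => |W x| ^ p) μ)
    (hWs : Integrable (fun x => |W x| ^ (n * p / (n - p))) μ) :
    Integrable (fun x => d x * |W x| ^ p) μ ∧
      ∫ x, d x * |W x| ^ p ∂μ ≤ h * ∫ x, |W x| ^ p ∂μ +
        h ^ (1 - q / n) * (lpNorm d (ENNReal.ofReal (q / p)) μ ^ (q / n) *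
          (∫ x, |W x| ^ (n * p / (n - p)) ∂μ) ^ ((n - p) / n)) := by
  have hn : 0 < n := by linarith
  have hnp : 0 < n - p := by linarith
  have hq0 : 0 < q := by linarith
  have hconj : (n / p).HolderConjugate (n / (n - p)) := by
    rw [Real.holderConjugate_iff]
    constructor
    · rw [lt_div_iff₀ hp]; linarith
    · field_simp; ring
  have e1 : q / n * (n / p) = q / p := by field_simp
  have e2 : p * (n / (n - p)) = n * p / (n - p) := by ring
  -- `d^(q/n)` lies in `L^{n/p}`, which is dual to the space `L^{n/(n-p)}` that contains `|W|^p`.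
  obtain ⟨h3, h4⟩ := integrable_and_integral_abs_rpow_mul_le (a := q / n) (b := p) hd.1 hW hconj
    (by rw [e1]; exact (memLp_ofReal_iff_integrable_abs_rpow hd.1 (by positivity)).1 hd)
    (by rwa [e2])
  rw [e1, e2, ← lpNorm_ofReal_rpow hd.1 (by positivity), ← Real.rpow_mul lpNorm_nonneg,
    show q / p * (1 / (n / p)) = q / n by field_simp,
    show 1 / (n / (n - p)) = (n - p) / n by field_simp] at h4
  have hle : ∀ᵐ x ∂μ, d x * |W x| ^ p ≤
      h * |W x| ^ p + h ^ (1 - q / n) * (|d x| ^ (q / n) * |W x| ^ p) := by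
    filter_upwards [hd0] with x hx
    have := mul_le_mul_of_nonneg_right
      (le_add_rpow_mul_rpow hx hh (κ := q / n) (by rw [le_div_iff₀ hn]; linarith))
      (Real.rpow_nonneg (abs_nonneg (W x)) p)
    rw [abs_of_nonneg hx]
    linarith
  have hbig := (hWp.const_mul h).add (h3.const_mul (h ^ (1 - q / n)))
  have hint : Integrable (fun x => d x * |W x| ^ p) μ := by
    refine hbig.mono' (hd.1.mul (hW.norm.aemeasurable.pow_const p).aestronglyMeasurable) ?_
    filter_upwards [hd0, hle] with x hx hx'
    rw [Real.norm_of_nonneg (mul_nonneg hx (Real.rpow_nonneg (abs_nonneg _) _))]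
    exact hx'
  refine ⟨hint, (integral_mono_ae hint hbig hle).trans ?_⟩
  rw [integral_add' (hWp.const_mul h) (h3.const_mul (h ^ (1 - q / n))), integral_const_mul,
    integral_const_mul]
  have : 0 ≤ h ^ (1 - q / n) := by positivity
  gcongr

/-- Fatou's lemma for nonnegative functions with uniformly bounded integrals. -/
theorem integrable_and_integral_le_of_tendsto {f : ℕ → α → ℝ} {F : α → ℝ} {K : ℝ}
    (hf0 : ∀ n x, 0 ≤ f n x) (hf : ∀ n, Integrable (f n) μ) (hK : ∀ n, ∫ x, f n x ∂μ ≤ K)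
    (hF : AEStronglyMeasurable F μ)
    (hlim : ∀ᵐ x ∂μ, Tendsto (fun n => f n x) atTop (𝓝 (F x))) :
    Integrable F μ ∧ ∫ x, F x ∂μ ≤ K := by
  have hF0 : 0 ≤ᵐ[μ] F := by
    filter_upwards [hlim] with x hx
    exact ge_of_tendsto' hx fun n => hf0 n x
  have hK0 : 0 ≤ K := (integral_nonneg (hf0 0)).trans (hK 0)
  have key : ∫⁻ x, ENNReal.ofReal (F x) ∂μ ≤ ENNReal.ofReal K := by
    calc ∫⁻ x, ENNReal.ofReal (F x) ∂μ
        = ∫⁻ x, liminf (fun n => ENNReal.ofReal (f n x)) atTop ∂μ := by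
          refine lintegral_congr_ae ?_
          filter_upwards [hlim] with x hx
          exact (ENNReal.tendsto_ofReal hx).liminf_eq.symm
      _ ≤ liminf (fun n => ∫⁻ x, ENNReal.ofReal (f n x) ∂μ) atTop :=
          lintegral_liminf_le' fun n => (hf n).1.aemeasurable.ennreal_ofReal
      _ ≤ ENNReal.ofReal K := by
          refine liminf_le_of_frequently_le' (Frequently.of_forall fun n => ?_)
          rw [← ofReal_integral_eq_lintegral_ofReal (hf n) (Eventually.of_forall (hf0 n))]
          exact ENNReal.ofReal_le_ofReal (hK n)
  have hint : Integrable F μ :=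
    ⟨hF, (hasFiniteIntegral_iff_ofReal hF0).2 (key.trans_lt ENNReal.ofReal_lt_top)⟩
  refine ⟨hint, ?_⟩
  rw [← ofReal_integral_eq_lintegral_ofReal hint hF0] at key
  exact (ENNReal.ofReal_le_ofReal_iff hK0).1 key

end RealPowerIntegrals

/-! ### The reverse Hölder inequality. -/

/-- Sobolev's inequality in `D^{1,p}(Ω)`, in terms of integrals. -/
theorem exists_integral_sobolev_constant (N : ℕ) {p : ℝ} (hp : 1 < p) (hpN : p < N) :
    ∃ S : ℝ, 0 < S ∧ ∀ (Ω : Set (EuclideanSpace ℝ (Fin N))) (u : EuclideanSpace ℝ (Fin N) → ℝ)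
      (G : EuclideanSpace ℝ (Fin N) → EuclideanSpace ℝ (Fin N)), MemBeppoLevi p Ω u G →
      (∫ x in Ω, |u x| ^ (N * p / (N - p))) ^ ((N - p) / N) ≤ S * ∫ x in Ω, ‖G x‖ ^ p := by
  obtain ⟨S, hS, h⟩ := exists_sobolev_constant N hp hpN
  refine ⟨S ^ p, by positivity, fun Ω u G hu => ?_⟩
  have hs := sobolevExponent_pos hp hpN
  have hp0 : 0 < p := by linarith
  have hN : (0 : ℝ) < N := by linarith
  have hNp : 0 < (N : ℝ) - p := by linarith
  have h1 := ENNReal.toReal_mono (ENNReal.mul_ne_top ENNReal.ofReal_ne_top hu.memLp_grad.2.ne)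
    (h Ω u G hu)
  rw [ENNReal.toReal_mul, ENNReal.toReal_ofReal hS.le, toReal_eLpNorm hu.memLp_fun.1,
    toReal_eLpNorm hu.memLp_grad.1, lpNorm_ofReal_eq hu.memLp_fun.1 hs,
    ← lpNorm_norm hu.memLp_grad.1, lpNorm_ofReal_eq hu.memLp_grad.1.norm hp0] at h1
  simp only [abs_norm] at h1
  have hI : 0 ≤ ∫ x in Ω, ‖G x‖ ^ p := integral_nonneg fun _ => by positivity
  have hJ := integral_abs_rpow_nonneg (μ := volume.restrict Ω) u (sobolevExponent N p)
  have h2 := Real.rpow_le_rpow (by positivity) h1 hp0.le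
  rw [Real.mul_rpow hS.le (by positivity), ← Real.rpow_mul hI, ← Real.rpow_mul hJ,
    one_div_mul_cancel hp0.ne', Real.rpow_one] at h2
  rwa [show 1 / sobolevExponent N p * p = (N - p) / N by rw [sobolevExponent]; field_simp,
    sobolevExponent] at h2

/-- The growth hypotheses on a quasilinear equation together with a weak solution. -/
structure IsControlledSolution {N : ℕ} (p β lam q : ℝ) (Ω : Set (EuclideanSpace ℝ (Fin N)))
    (A : EuclideanSpace ℝ (Fin N) → ℝ → EuclideanSpace ℝ (Fin N) → EuclideanSpace ℝ (Fin N))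
    (B : EuclideanSpace ℝ (Fin N) → ℝ → EuclideanSpace ℝ (Fin N) → ℝ)
    (a₁ a₂ b₁ b₂ b₃ : EuclideanSpace ℝ (Fin N) → ℝ) (u : EuclideanSpace ℝ (Fin N) → ℝ)
    (G : EuclideanSpace ℝ (Fin N) → EuclideanSpace ℝ (Fin N)) : Prop where
  nonneg : ∀ᵐ x ∂(volume.restrict Ω), 0 ≤ a₁ x ∧ 0 ≤ a₂ x ∧ 0 ≤ b₁ x ∧ 0 ≤ b₂ x ∧ 0 ≤ b₃ x
  structA : StructureA p lam Ω A a₁ a₂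
  structB : StructureB p Ω B b₁ b₂ b₃
  memLp_b₁ : MemLp b₁ ⊤ (volume.restrict Ω)
  memLp_a₁ : MemLp a₁ (ENNReal.ofReal (q / p)) (volume.restrict Ω)
  memLp_b₂ : MemLp b₂ (ENNReal.ofReal (q / p)) (volume.restrict Ω)
  memLp_a₂ : MemLp a₂ (ENNReal.ofReal (β / p)) (volume.restrict Ω)
  memLp_top_a₂ : MemLp a₂ ⊤ (volume.restrict Ω)
  memLp_b₃ : MemLp b₃ (ENNReal.ofReal (β / (p - 1))) (volume.restrict Ω)
  memLp_top_b₃ : MemLp b₃ ⊤ (volume.restrict Ω)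
  sol : IsWeakSolution p Ω A B u G

/-- After multiplication by `S`, each of the two potentials contributes at most `(lam/8) Y`.
Together they consume half of `(lam/2) Y`, and the remaining `(lam/4) Y` gives the factor `4 S /
lam`. -/
theorem le_of_absorption {lam S m X I Y E Z h₁ h₂ c δ₁ δ₂ : ℝ} (hlam : 0 < lam) (hS : 0 < S)
    (hm : 0 < m) (hXI : X ≤ I) (hY : 0 ≤ Y) (hh₁ : 0 ≤ h₁) (hh₂ : 0 ≤ h₂) (hc : 0 ≤ c)
    (hYE : Y ≤ S * E) (hE : lam / 2 * E ≤ m * ((h₁ * X + δ₁ * Y) + (h₂ * X + δ₂ * Y) + c * X) + Z)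
    (hδ₁ : δ₁ ≤ lam / (8 * S * m)) (hδ₂ : δ₂ ≤ lam / (8 * S * m)) :
    Y ≤ 4 * S / lam * (m * (h₁ + h₂ + c) * I + Z) := by
  rw [le_div_iff₀ (by positivity)] at hδ₁ hδ₂
  have h1 : lam / 2 * Y ≤ S * (m * ((h₁ * X + δ₁ * Y) + (h₂ * X + δ₂ * Y) + c * X) + Z) := by
    calc lam / 2 * Y ≤ lam / 2 * (S * E) := by gcongr
      _ = S * (lam / 2 * E) := by ring
      _ ≤ _ := by gcongr
  have h2 : (h₁ + h₂ + c) * X ≤ (h₁ + h₂ + c) * I := by gcongr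
  have h3 := mul_le_mul_of_nonneg_left h2 (mul_pos hS hm).le
  have h4 := mul_le_mul_of_nonneg_right hδ₁ hY
  have h5 := mul_le_mul_of_nonneg_right hδ₂ hY
  rw [div_mul_eq_mul_div, le_div_iff₀ hlam]
  nlinarith

/-- The coefficient of `∫ |W|^p` produced by absorbing a potential of `L^{q/p}` norm `D`. -/
noncomputable def absorptionConst (n q lam S D : ℝ) : ℝ :=
  (8 * S * (D + 1) ^ (q / n) / lam) ^ (n / (q - n))

theorem absorptionConst_pos {n q lam S D : ℝ} (hlam : 0 < lam) (hS : 0 < S) (hD : 0 ≤ D) :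
    0 < absorptionConst n q lam S D := by
  unfold absorptionConst; positivity

theorem absorptionConst_mono {n q lam S D D' : ℝ} (hn : 0 < n) (hq : n < q) (hlam : 0 < lam)
    (hS : 0 < S) (hD : 0 ≤ D) (h : D ≤ D') :
    absorptionConst n q lam S D ≤ absorptionConst n q lam S D' := by
  unfold absorptionConst
  have h1 : 0 ≤ n / (q - n) := div_nonneg hn.le (by linarith)
  have h2 : 0 ≤ q / n := div_nonneg (by linarith) hn.le
  gcongr

/-- The exponent `n/(q-n)` is chosen so that raising to the power `1 - q/n` yields exactly an
inverse. Using `D + 1` in place of `D` keeps the base positive when `D = 0`. -/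
theorem absorptionConst_spec {n q lam S D m : ℝ} (hn : 0 < n) (hq : n < q) (hlam : 0 < lam)
    (hS : 0 < S) (hD : 0 ≤ D) (hm : 0 < m) :
    (absorptionConst n q lam S D * m ^ (n / (q - n))) ^ (1 - q / n) * D ^ (q / n) ≤
      lam / (8 * S * m) := by
  have hqn : 0 < q - n := by linarith
  have hD1 : 0 < (D + 1) ^ (q / n) := by positivity
  have h0 : 0 ≤ 8 * S * (D + 1) ^ (q / n) / lam := by positivity
  rw [absorptionConst, ← Real.mul_rpow h0 hm.le, ← Real.rpow_mul (by positivity),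
    show n / (q - n) * (1 - q / n) = -1 by field_simp; ring, Real.rpow_neg_one]
  have h1 : D ^ (q / n) ≤ (D + 1) ^ (q / n) :=
    Real.rpow_le_rpow hD (by linarith) (div_nonneg (by linarith) hn.le)
  calc (8 * S * (D + 1) ^ (q / n) / lam * m)⁻¹ * D ^ (q / n)
      ≤ (8 * S * (D + 1) ^ (q / n) / lam * m)⁻¹ * (D + 1) ^ (q / n) := by gcongr
    _ = lam / (8 * S * m) := by field_simp

/-- The constant in the reverse Hölder inequality. -/
noncomputable def reverseHolderConst (n p q lam S β₁ D₁ D₂ : ℝ) : ℝ :=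
  4 * S / lam * (absorptionConst n q lam S D₁ + absorptionConst n q lam S D₂ +
    (2 / lam) ^ (p - 1) * β₁ ^ p + 1)

-- One Moser step at truncation level `k`. Truncation makes the test function admissible and the
-- critical integral of `W` finite beforehand, and the bound does not involve `k`.
set_option maxHeartbeats 1000000 in
theorem IsControlledSolution.truncated_estimate {N : ℕ} {p β lam q : ℝ} (hp : 1 < p)
    (hpN : p < N) (hβ : p < β) (hlam : 0 < lam) (hq : N < q) {S : ℝ} (hS : 0 < S)
    {Ω : Set (EuclideanSpace ℝ (Fin N))}
    (hSob : ∀ (u : EuclideanSpace ℝ (Fin N) → ℝ)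
      (G : EuclideanSpace ℝ (Fin N) → EuclideanSpace ℝ (Fin N)), MemBeppoLevi p Ω u G →
      (∫ x in Ω, |u x| ^ (N * p / (N - p))) ^ ((N - p) / N) ≤ S * ∫ x in Ω, ‖G x‖ ^ p)
    {A : EuclideanSpace ℝ (Fin N) → ℝ → EuclideanSpace ℝ (Fin N) → EuclideanSpace ℝ (Fin N)}
    {B : EuclideanSpace ℝ (Fin N) → ℝ → EuclideanSpace ℝ (Fin N) → ℝ}
    {a₁ a₂ b₁ b₂ b₃ : EuclideanSpace ℝ (Fin N) → ℝ} {u : EuclideanSpace ℝ (Fin N) → ℝ}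
    {G : EuclideanSpace ℝ (Fin N) → EuclideanSpace ℝ (Fin N)}
    (h : IsControlledSolution p β lam q Ω A B a₁ a₂ b₁ b₂ b₃ u G) {s : ℝ} (hs : β ≤ s)
    (hus : Integrable (fun x => |u x| ^ s) (volume.restrict Ω)) {k : ℝ} (hk : 0 < k) :
    Integrable (fun x => (|u x| * truncPow k ((s - p) / p) (u x)) ^ (N * p / (N - p)))
        (volume.restrict Ω) ∧
      (∫ x in Ω, (|u x| * truncPow k ((s - p) / p) (u x)) ^ (N * p / (N - p))) ^ ((N - p) / N) ≤
        reverseHolderConst N p q lam S (lpNorm b₁ ⊤ (volume.restrict Ω))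
          (lpNorm a₁ (ENNReal.ofReal (q / p)) (volume.restrict Ω))
          (lpNorm b₂ (ENNReal.ofReal (q / p)) (volume.restrict Ω)) *
        (s / p) ^ (2 * p + p * (N / (q - N))) *
        ((∫ x in Ω, |u x| ^ s) +
          lebSupNorm Ω (ENNReal.ofReal (β / p)) a₂ * (∫ x in Ω, |u x| ^ s) ^ ((s - p) / s) +
          lebSupNorm Ω (ENNReal.ofReal (β / (p - 1))) b₃ *
            (∫ x in Ω, |u x| ^ s) ^ ((s - (p - 1)) / s)) := by
  have hp0 : 0 < p := by linarith
  have hN : (0 : ℝ) < N := by linarith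
  have hNp : 0 < (N : ℝ) - p := by linarith
  have hsp : 0 < s - p := by linarith
  have ha : 0 < (s - p) / p := by positivity
  have ham : (s - p) / p + 1 = s / p := by field_simp; ring
  have hm1 : 1 ≤ s / p := by rw [one_le_div hp0]; linarith
  have hm0 : 0 < s / p := by linarith
  have hr0 : 0 < (N : ℝ) * p / (N - p) := by positivity
  have hap : (s - p) / p * p = s - p := by field_simp
  set μ := (volume : Measure (EuclideanSpace ℝ (Fin N))).restrict Ω with hμ
  have hum : AEStronglyMeasurable u μ := h.sol.mem.memLp_fun.1
  -- `W` uses the exponent `(s-p)/p` and the test function uses `s-p`, so that `|∇W|^p` is exactly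
  -- the weighted energy density of the energy estimate.
  have hW := h.sol.mem.intervalIntegral_comp hp hpN (continuous_truncPow (k := k) ha.le)
    (fun t => (abs_of_nonneg (truncPow_nonneg hk t)).trans_le (truncPow_le_const hk ha.le t))
  set W := fun x => ∫ t in (0 : ℝ)..u x, truncPow k ((s - p) / p) t with hWdef
  have hWm : AEStronglyMeasurable W μ := hW.memLp_fun.1
  have hWs : Integrable (fun x => |W x| ^ (N * p / (N - p))) μ :=
    (memLp_ofReal_iff_integrable_abs_rpow hWm hr0).1 hW.memLp_fun
  have hWle : ∀ x, |W x| ^ p ≤ |u x| ^ s := by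
    intro x
    calc |W x| ^ p ≤ (|u x| * |u x| ^ ((s - p) / p)) ^ p := by
          gcongr
          exact (abs_integral_truncPow_le hk ha.le _).trans
            (by gcongr; exact truncPow_le_rpow hk ha.le _)
      _ = |u x| ^ s := by
          rw [mul_comm, ← Real.rpow_add_one' (abs_nonneg _) (by linarith), ham,
            ← Real.rpow_mul (abs_nonneg _), div_mul_cancel₀ _ hp0.ne']
  have hWp : Integrable (fun x => |W x| ^ p) μ := by
    refine hus.mono' (hWm.norm.aemeasurable.pow_const p).aestronglyMeasurable
      (Eventually.of_forall fun x => ?_)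
    rw [Real.norm_of_nonneg (by positivity)]
    exact hWle x
  have hXI : ∫ x, |W x| ^ p ∂μ ≤ ∫ x, |u x| ^ s ∂μ := integral_mono hWp hus hWle
  have hWge : ∀ x, |u x| * truncPow k ((s - p) / p) (u x) ≤ s / p * |W x| := by
    intro x
    rw [← ham]
    exact abs_mul_truncPow_le_integral hk ha _
  have hg0 : ∀ t, 0 ≤ truncPow k ((s - p) / p) t := truncPow_nonneg hk
  have hgW : ∀ x, |u x| ^ p * truncPow k (s - p) (u x) ≤ (s / p) ^ p * |W x| ^ p := by
    intro x
    rw [← hap, ← truncPow_rpow hk, ← Real.mul_rpow (abs_nonneg _) (hg0 _),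
      ← Real.mul_rpow hm0.le (abs_nonneg _)]
    exact Real.rpow_le_rpow (mul_nonneg (abs_nonneg _) (hg0 _)) (hWge x) hp0.le
  set I := ∫ x, |u x| ^ s ∂μ with hI
  have hI0 : 0 ≤ I := integral_abs_rpow_nonneg u s
  set Y := (∫ x, |W x| ^ (N * p / (N - p)) ∂μ) ^ ((N - p) / N) with hY
  have hY0 : 0 ≤ Y := Real.rpow_nonneg (integral_abs_rpow_nonneg W _) _
  set D₁ := lpNorm a₁ (ENNReal.ofReal (q / p)) μ with hD₁
  set D₂ := lpNorm b₂ (ENNReal.ofReal (q / p)) μ with hD₂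
  set β₁ := lpNorm b₁ ⊤ μ with hβ₁
  have hD₁0 : 0 ≤ D₁ := lpNorm_nonneg
  have hD₂0 : 0 ≤ D₂ := lpNorm_nonneg
  have hβ₁0 : 0 ≤ β₁ := lpNorm_nonneg
  set M := (s / p) ^ p with hM
  have hM0 : 0 < M := by positivity
  -- Replacing `|u|^p min(|u|,k)^(s-p)` by `|W|^p` costs a factor `M`. The power of `M` here makes
  -- the coefficient of the critical term small enough to survive that factor.
  set h₁ := absorptionConst N q lam S D₁ * M ^ ((N : ℝ) / (q - N)) with hh₁
  set h₂ := absorptionConst N q lam S D₂ * M ^ ((N : ℝ) / (q - N)) with hh₂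
  have hH₁ := absorptionConst_pos (n := N) (q := q) hlam hS hD₁0
  have hH₂ := absorptionConst_pos (n := N) (q := q) hlam hS hD₂0
  have hh₁0 : 0 < h₁ := by positivity
  have hh₂0 : 0 < h₂ := by positivity
  set c := (2 / lam) ^ (p - 1) * β₁ ^ p with hc
  have hc0 : 0 ≤ c := by positivity
  have hnn := h.nonneg
  obtain ⟨i₁, e₁⟩ := integrable_and_integral_potential_le hp0 hpN hq hh₁0
    (hnn.mono fun x hx => hx.1) h.memLp_a₁ hWm hWp hWs
  obtain ⟨i₂, e₂⟩ := integrable_and_integral_potential_le hp0 hpN hq hh₂0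
    (hnn.mono fun x hx => hx.2.2.2.1) h.memLp_b₂ hWm hWp hWs
  obtain ⟨j₂, f₂⟩ := integrable_and_integral_mul_rpow_sub_le hp0 hβ hs
    (hnn.mono fun x hx => hx.2.1) h.memLp_a₂ h.memLp_top_a₂ hum hus
  obtain ⟨j₃, f₃⟩ := integrable_and_integral_mul_rpow_sub_le (by linarith : 0 < p - 1)
    (by linarith) hs (hnn.mono fun x hx => hx.2.2.2.2) h.memLp_b₃ h.memLp_top_b₃ hum hus
  have iW := (((i₁.add i₂).add (hWp.const_mul c)).const_mul M)
  have iQ := (iW.add j₂).add j₃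
  set R := fun x => ((a₁ x + b₂ x + c) * |u x| ^ p + a₂ x + b₃ x * |u x|) *
    truncPow k (s - p) (u x) with hR
  have hRle : ∀ᵐ x ∂μ, 0 ≤ R x ∧ R x ≤ M * (a₁ x * |W x| ^ p + b₂ x * |W x| ^ p + c * |W x| ^ p) +
      a₂ x * |u x| ^ (s - p) + b₃ x * |u x| ^ (s - (p - 1)) := by
    filter_upwards [hnn] with x ⟨h1, h2, h3, h4, h5⟩
    have h6 := truncPow_nonneg (a := s - p) hk (u x)
    have h7 := truncPow_le_rpow hk hsp.le (u x)
    refine ⟨by simp only [hR]; positivity, ?_⟩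
    have h8 : |u x| ^ (s - (p - 1)) = |u x| ^ (s - p) * |u x| := by
      rw [← Real.rpow_add_one' (abs_nonneg _) (by linarith)]
      congr 1; ring
    have h9 := mul_le_mul_of_nonneg_left (hgW x) (by positivity : 0 ≤ a₁ x + b₂ x + c)
    have h10 := mul_le_mul_of_nonneg_left h7 (by positivity : 0 ≤ a₂ x + b₃ x * |u x|)
    rw [h8]
    simp only [hR]
    linarith
  have hRm : AEStronglyMeasurable R μ := by
    refine AEStronglyMeasurable.mul ?_
      ((continuous_truncPow hsp.le).comp_aestronglyMeasurable hum)
    refine ((AEStronglyMeasurable.mul ?_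
      (hum.norm.aemeasurable.pow_const p).aestronglyMeasurable).add h.memLp_a₂.1).add
      (h.memLp_b₃.1.mul hum.norm)
    exact (h.memLp_a₁.1.add h.memLp_b₂.1).add aestronglyMeasurable_const
  have iR : Integrable R μ := by
    refine iQ.mono' hRm (hRle.mono fun x hx => ?_)
    rw [Real.norm_of_nonneg hx.1]
    exact hx.2
  have hRint := integral_mono_ae iR iQ (hRle.mono fun x hx => hx.2)
  rw [integral_add' (iW.add j₂) j₃, integral_add' iW j₂, integral_const_mul,
    integral_add' (i₁.add i₂) (hWp.const_mul c), integral_add' i₁ i₂, integral_const_mul] at hRint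
  have hen := h.sol.energy_le hp hpN hlam hnn h.structA h.structB
    ((ae_le_lpNorm_exponent_top h.memLp_b₁).mono fun x hx => (le_abs_self _).trans hx)
    (continuous_truncPow hsp.le) (truncPow_nonneg hk) (truncPow_le_const hk hsp.le)
    (abs_integral_truncPow_le hk hsp.le) iR
  have hYE := hSob _ _ hW
  have hgrad : ∀ x, ‖truncPow k ((s - p) / p) (u x) • G x‖ ^ p
      = truncPow k (s - p) (u x) * ‖G x‖ ^ p := by
    intro x
    rw [norm_smul, Real.norm_of_nonneg (hg0 _), Real.mul_rpow (hg0 _) (norm_nonneg _),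
      truncPow_rpow hk, hap]
  simp_rw [hgrad] at hYE
  set Z := lebSupNorm Ω (ENNReal.ofReal (β / p)) a₂ * I ^ ((s - p) / s) +
    lebSupNorm Ω (ENNReal.ofReal (β / (p - 1))) b₃ * I ^ ((s - (p - 1)) / s) with hZ
  have hZ0 : 0 ≤ Z := by
    refine add_nonneg (mul_nonneg (add_nonneg lpNorm_nonneg lpNorm_nonneg) ?_)
      (mul_nonneg (add_nonneg lpNorm_nonneg lpNorm_nonneg) ?_) <;> exact Real.rpow_nonneg hI0 _
  have hmain := le_of_absorption (Z := Z) hlam hS hM0 hXI hY0 hh₁0.le hh₂0.le hc0 hYE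
    (δ₁ := h₁ ^ (1 - q / N) * D₁ ^ (q / N)) (δ₂ := h₂ ^ (1 - q / N) * D₂ ^ (q / N))
    (by
      refine hen.trans (hRint.trans ?_)
      rw [add_assoc]
      refine add_le_add (mul_le_mul_of_nonneg_left (add_le_add (add_le_add ?_ ?_) le_rfl) hM0.le)
        (add_le_add f₂ f₃)
      · exact e₁.trans_eq (by rw [mul_assoc (h₁ ^ _)])
      · exact e₂.trans_eq (by rw [mul_assoc (h₂ ^ _)]))
    (absorptionConst_spec hN hq hlam hS hD₁0 hM0) (absorptionConst_spec hN hq hlam hS hD₂0 hM0)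
  have hVs : Integrable (fun x => (|u x| * truncPow k ((s - p) / p) (u x)) ^ (N * p / (N - p))) μ ∧
      ∫ x, (|u x| * truncPow k ((s - p) / p) (u x)) ^ (N * p / (N - p)) ∂μ ≤
        (s / p) ^ (N * p / (N - p)) * ∫ x, |W x| ^ (N * p / (N - p)) ∂μ := by
    have hle : ∀ x, (|u x| * truncPow k ((s - p) / p) (u x)) ^ (N * p / (N - p)) ≤
        (s / p) ^ (N * p / (N - p)) * |W x| ^ (N * p / (N - p)) := by
      intro x
      rw [← Real.mul_rpow hm0.le (abs_nonneg _)]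
      exact Real.rpow_le_rpow (mul_nonneg (abs_nonneg _) (hg0 _)) (hWge x) hr0.le
    have hint : Integrable
        (fun x => (|u x| * truncPow k ((s - p) / p) (u x)) ^ (N * p / (N - p))) μ := by
      refine (hWs.const_mul ((s / p) ^ (N * p / (N - p)))).mono' ?_ (Eventually.of_forall fun x => ?_)
      · exact ((hum.norm.mul ((continuous_truncPow ha.le).comp_aestronglyMeasurable
          hum)).aemeasurable.pow_const _).aestronglyMeasurable
      · rw [Real.norm_of_nonneg (Real.rpow_nonneg (mul_nonneg (abs_nonneg _) (hg0 _)) _)]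
        exact hle x
    refine ⟨hint, ?_⟩
    rw [← integral_const_mul]
    exact integral_mono hint (hWs.const_mul _) hle
  refine ⟨hVs.1, ?_⟩
  set γ := (N : ℝ) / (q - N) with hγ
  have hγ0 : 0 < γ := div_pos hN (by linarith)
  have hMγ : M ^ γ = (s / p) ^ (p * γ) := (Real.rpow_mul hm0.le p γ).symm
  have hMγ1 : 1 ≤ M ^ γ := by
    rw [hMγ]; exact Real.one_le_rpow hm1 (by positivity)
  have hM1 : 1 ≤ M := Real.one_le_rpow hm1 hp0.le
  calc (∫ x, (|u x| * truncPow k ((s - p) / p) (u x)) ^ (N * p / (N - p)) ∂μ) ^ ((N - p) / N)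
      ≤ ((s / p) ^ (N * p / (N - p)) * ∫ x, |W x| ^ (N * p / (N - p)) ∂μ) ^ ((N - p) / N) :=
        Real.rpow_le_rpow (integral_nonneg fun x =>
          Real.rpow_nonneg (mul_nonneg (abs_nonneg _) (hg0 _)) _) hVs.2 (by positivity)
    _ = M * Y := by
        rw [Real.mul_rpow (by positivity) (integral_abs_rpow_nonneg W _), ← Real.rpow_mul hm0.le,
          show N * p / (N - p) * ((N - p) / N) = p by field_simp]
    _ ≤ M * (4 * S / lam * (M * (h₁ + h₂ + c) * I + Z)) := by gcongr
    -- The summand `1` in the constant pays for `Z`. Of the factors `M`, one comes from bounding the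
    -- potentials by `W`, the outer one from returning from `W` to `u`, and `M ^ γ` from absorption;
    -- hence the exponent `2p + pγ` of `s/p`.
    _ ≤ M * (4 * S / lam * ((M * M ^ γ) * (absorptionConst N q lam S D₁ +
          absorptionConst N q lam S D₂ + c + 1) * (I + Z))) := by
        gcongr
        have h1 : h₁ + h₂ + c ≤ M ^ γ * (absorptionConst N q lam S D₁ +
          absorptionConst N q lam S D₂ + c) := by
          rw [hh₁, hh₂]; nlinarith
        have h2 := mul_le_mul_of_nonneg_left h1 (mul_nonneg hM0.le hI0)
        have h3 : 1 ≤ M * M ^ γ := one_le_mul_of_one_le_of_one_le hM1 hMγ1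
        have h4 : 0 ≤ (M * M ^ γ) * (absorptionConst N q lam S D₁ +
          absorptionConst N q lam S D₂ + c) * Z := by positivity
        have h5 : 0 ≤ (M * M ^ γ) * I := by positivity
        nlinarith
    _ = _ := by
        rw [reverseHolderConst, hMγ, show 2 * p + p * γ = p + (p + p * γ) by ring,
          Real.rpow_add hm0, Real.rpow_add hm0, ← hM, hZ]
        ring

/-- Reverse Hölder inequality between consecutive Moser exponents. -/
theorem IsControlledSolution.reverse_holder {N : ℕ} {p β lam q : ℝ} (hp : 1 < p)
    (hpN : p < N) (hβ : p < β) (hlam : 0 < lam) (hq : N < q) {S : ℝ} (hS : 0 < S)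
    {Ω : Set (EuclideanSpace ℝ (Fin N))}
    (hSob : ∀ (u : EuclideanSpace ℝ (Fin N) → ℝ)
      (G : EuclideanSpace ℝ (Fin N) → EuclideanSpace ℝ (Fin N)), MemBeppoLevi p Ω u G →
      (∫ x in Ω, |u x| ^ (N * p / (N - p))) ^ ((N - p) / N) ≤ S * ∫ x in Ω, ‖G x‖ ^ p)
    {A : EuclideanSpace ℝ (Fin N) → ℝ → EuclideanSpace ℝ (Fin N) → EuclideanSpace ℝ (Fin N)}
    {B : EuclideanSpace ℝ (Fin N) → ℝ → EuclideanSpace ℝ (Fin N) → ℝ}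
    {a₁ a₂ b₁ b₂ b₃ : EuclideanSpace ℝ (Fin N) → ℝ} {u : EuclideanSpace ℝ (Fin N) → ℝ}
    {G : EuclideanSpace ℝ (Fin N) → EuclideanSpace ℝ (Fin N)}
    (h : IsControlledSolution p β lam q Ω A B a₁ a₂ b₁ b₂ b₃ u G) {s : ℝ} (hs : β ≤ s)
    (hus : Integrable (fun x => |u x| ^ s) (volume.restrict Ω)) :
    Integrable (fun x => |u x| ^ (s * (N / (N - p)))) (volume.restrict Ω) ∧
      (∫ x in Ω, |u x| ^ (s * (N / (N - p)))) ^ ((N - p) / N) ≤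
        reverseHolderConst N p q lam S (lpNorm b₁ ⊤ (volume.restrict Ω))
          (lpNorm a₁ (ENNReal.ofReal (q / p)) (volume.restrict Ω))
          (lpNorm b₂ (ENNReal.ofReal (q / p)) (volume.restrict Ω)) *
        (s / p) ^ (2 * p + p * (N / (q - N))) *
        ((∫ x in Ω, |u x| ^ s) +
          lebSupNorm Ω (ENNReal.ofReal (β / p)) a₂ * (∫ x in Ω, |u x| ^ s) ^ ((s - p) / s) +
          lebSupNorm Ω (ENNReal.ofReal (β / (p - 1))) b₃ *
            (∫ x in Ω, |u x| ^ s) ^ ((s - (p - 1)) / s)) := by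
  have hp0 : 0 < p := by linarith
  have hN : (0 : ℝ) < N := by linarith
  have hNp : 0 < (N : ℝ) - p := by linarith
  have hsp : 0 < s - p := by linarith
  have ha : 0 < (s - p) / p := by positivity
  have hest := fun n : ℕ => h.truncated_estimate hp hpN hβ hlam hq hS hSob hs hus
    (k := (n : ℝ) + 1) (by positivity)
  set K := reverseHolderConst N p q lam S (lpNorm b₁ ⊤ (volume.restrict Ω))
          (lpNorm a₁ (ENNReal.ofReal (q / p)) (volume.restrict Ω))
          (lpNorm b₂ (ENNReal.ofReal (q / p)) (volume.restrict Ω)) *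
        (s / p) ^ (2 * p + p * (N / (q - N))) *
        ((∫ x in Ω, |u x| ^ s) +
          lebSupNorm Ω (ENNReal.ofReal (β / p)) a₂ * (∫ x in Ω, |u x| ^ s) ^ ((s - p) / s) +
          lebSupNorm Ω (ENNReal.ofReal (β / (p - 1))) b₃ *
            (∫ x in Ω, |u x| ^ s) ^ ((s - (p - 1)) / s)) with hK
  have hf0 : ∀ (n : ℕ) x, 0 ≤ (|u x| * truncPow ((n : ℝ) + 1) ((s - p) / p) (u x)) ^
      (N * p / (N - p)) := fun n x =>
    Real.rpow_nonneg (mul_nonneg (abs_nonneg _) (truncPow_nonneg (by positivity) _)) _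
  have hK0 : 0 ≤ K := (Real.rpow_nonneg (integral_nonneg (hf0 0)) _).trans (hest 0).2
  have hle : ∀ n : ℕ, ∫ x in Ω, (|u x| * truncPow ((n : ℝ) + 1) ((s - p) / p) (u x)) ^
      (N * p / (N - p)) ≤ K ^ (N / (N - p)) := by
    intro n
    have := Real.rpow_le_rpow (Real.rpow_nonneg (integral_nonneg (hf0 n)) _) (hest n).2
      (by positivity : 0 ≤ N / (N - p))
    rwa [← Real.rpow_mul (integral_nonneg (hf0 n)),
      show (N - p) / N * (N / (N - p)) = 1 by field_simp, Real.rpow_one] at this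
  obtain ⟨h1, h2⟩ := integrable_and_integral_le_of_tendsto
    (F := fun x => |u x| ^ (s * (N / (N - p)))) hf0 (fun n => (hest n).1) hle
    (h.sol.mem.memLp_fun.1.norm.aemeasurable.pow_const _).aestronglyMeasurable
    (Eventually.of_forall fun x => by
      -- At a fixed point the truncation is inactive once the level exceeds `|u x|`, so the sequence
      -- is eventually constant.
      refine tendsto_const_nhds.congr' ?_
      filter_upwards [eventually_ge_atTop ⌈|u x|⌉₊] with n hn
      have hn' : |u x| ≤ (n : ℝ) + 1 := by
        have := (Nat.le_ceil |u x|).trans (Nat.cast_le.2 hn)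
        linarith
      rw [truncPow, min_eq_left hn', mul_comm |u x|,
        ← Real.rpow_add_one' (abs_nonneg _) (by linarith),
        ← Real.rpow_mul (abs_nonneg _)]
      congr 1
      field_simp
      ring)
  refine ⟨h1, ?_⟩
  have := Real.rpow_le_rpow (integral_abs_rpow_nonneg u _) h2 (by positivity : 0 ≤ (N - p) / N)
  rwa [← Real.rpow_mul hK0, show N / (N - p) * ((N - p) / N) = 1 by field_simp,
    Real.rpow_one] at this

/-! ### Numerical lemmas for the iteration. -/

section MoserIteration

/-- For `v ≥ 1` every term is at most `v`. For `v ≤ 1` the smallest exponent gives the largest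
power, and exponents multiply. -/
theorem max_rpow_step_le {v θ δ : ℝ} (hv : 0 ≤ v) (hθ : 0 < θ) (hθ1 : θ ≤ 1) (hδ : 0 ≤ δ)
    (hδ1 : δ < 1) :
    max (max v (v ^ θ)) (max v (v ^ θ) ^ (1 - δ)) ≤ max v (v ^ (θ * (1 - δ))) := by
  rcases le_total 1 v with h | h
  · have h1 : max v (v ^ θ) = v := max_eq_left (Real.rpow_le_self_of_one_le h hθ1)
    rw [h1]
    exact max_le (le_max_left _ _)
      ((Real.rpow_le_self_of_one_le h (by linarith)).trans (le_max_left _ _))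
  · have h1 : max v (v ^ θ) = v ^ θ := max_eq_right (by
      simpa using Real.rpow_le_rpow_of_exponent_ge' hv h hθ.le hθ1)
    have h2 : v ^ θ ≤ (v ^ θ) ^ (1 - δ) := by
      simpa using Real.rpow_le_rpow_of_exponent_ge' (Real.rpow_nonneg hv θ)
        (Real.rpow_le_one hv h hθ.le) (by linarith : 0 ≤ 1 - δ) (by linarith : 1 - δ ≤ 1)
    rw [h1, max_eq_right h2, ← Real.rpow_mul hv]
    exact le_max_right _ _

/-- The accumulated factor `P` is at least `1`, so `P^(1-δ) ≤ P`: the constants simply multiply and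
the defects only act on the exponent of `v 0`. -/
theorem iterate_le_exp_sum_mul_max {v k δ : ℕ → ℝ} (hv : ∀ n, 0 ≤ v n) (hk : ∀ n, 0 ≤ k n)
    (hδ : ∀ n, 0 ≤ δ n) (hδ1 : ∀ n, δ n < 1)
    (h : ∀ n, v (n + 1) ≤ Real.exp (k n) * max (v n) (v n ^ (1 - δ n))) (n : ℕ) :
    v n ≤ Real.exp (∑ i ∈ Finset.range n, k i) *
      max (v 0) (v 0 ^ (∏ i ∈ Finset.range n, (1 - δ i))) := by
  induction n with
  | zero => simp
  | succ n ih =>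
    set P := Real.exp (∑ i ∈ Finset.range n, k i)
    set θ := ∏ i ∈ Finset.range n, (1 - δ i) with hθ
    have hP : 1 ≤ P := Real.one_le_exp (Finset.sum_nonneg fun i _ => hk i)
    have hθ0 : 0 < θ := Finset.prod_pos fun i _ => by linarith [hδ1 i]
    have hθ1 : θ ≤ 1 := Finset.prod_le_one (fun i _ => by linarith [hδ1 i])
      fun i _ => by linarith [hδ i]
    set w := max (v 0) (v 0 ^ θ)
    have hw : 0 ≤ w := (hv 0).trans (le_max_left _ _)
    have h1 : max (v n) (v n ^ (1 - δ n)) ≤ P * max w (w ^ (1 - δ n)) := by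
      refine max_le (ih.trans (by gcongr; exact le_max_left _ _)) ?_
      calc v n ^ (1 - δ n) ≤ (P * w) ^ (1 - δ n) :=
            Real.rpow_le_rpow (hv n) ih (by linarith [hδ1 n])
        _ = P ^ (1 - δ n) * w ^ (1 - δ n) := Real.mul_rpow (by linarith) hw
        _ ≤ P * max w (w ^ (1 - δ n)) := by
            gcongr
            · exact Real.rpow_le_self_of_one_le hP (by linarith [hδ n])
            · exact le_max_right _ _
    rw [Finset.sum_range_succ, Finset.prod_range_succ, Real.exp_add]
    calc v (n + 1) ≤ Real.exp (k n) * max (v n) (v n ^ (1 - δ n)) := h n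
      _ ≤ Real.exp (k n) * (P * max (v 0) (v 0 ^ (θ * (1 - δ n)))) := by
          gcongr
          exact h1.trans (mul_le_mul_of_nonneg_left
            (max_rpow_step_le (hv 0) hθ0 hθ1 (hδ n) (hδ1 n)) (by linarith))
      _ = _ := by ring

theorem exp_neg_div_one_sub_le {x : ℝ} (hx : x < 1) : Real.exp (-(x / (1 - x))) ≤ 1 - x := by
  have h1 : 0 < 1 - x := by linarith
  rw [Real.exp_neg, inv_le_comm₀ (Real.exp_pos _) h1]
  calc (1 - x)⁻¹ = x / (1 - x) + 1 := by field_simp; ring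
    _ ≤ _ := Real.add_one_le_exp _

/-- Each factor satisfies `1 - x ≥ exp(-x/(1-x))` with `x = δ ρ^i ≤ δ`, and the exponents are summed
by the geometric series. This lower bound, uniform in `n`, is the source of `θ₀`. -/
theorem exp_le_prod_one_sub_geometric {δ ρ : ℝ} (hδ : 0 ≤ δ) (hδ1 : δ < 1) (hρ : 0 ≤ ρ)
    (hρ1 : ρ < 1) (n : ℕ) :
    Real.exp (-(δ / (1 - δ) * (1 - ρ)⁻¹)) ≤ ∏ i ∈ Finset.range n, (1 - δ * ρ ^ i) := by
  have h1 : 0 < 1 - δ := by linarith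
  calc Real.exp (-(δ / (1 - δ) * (1 - ρ)⁻¹))
      ≤ Real.exp (∑ i ∈ Finset.range n, -(δ / (1 - δ) * ρ ^ i)) := by
        rw [Real.exp_le_exp, Finset.sum_neg_distrib, neg_le_neg_iff, ← Finset.mul_sum]
        gcongr
        rw [← tsum_geometric_of_lt_one hρ hρ1]
        exact (summable_geometric_of_lt_one hρ hρ1).sum_le_tsum _ fun i _ => by positivity
    _ = ∏ i ∈ Finset.range n, Real.exp (-(δ / (1 - δ) * ρ ^ i)) := Real.exp_sum _ _
    _ ≤ _ := by
        refine Finset.prod_le_prod (fun i _ => (Real.exp_pos _).le) fun i _ => ?_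
        have h2 : δ * ρ ^ i ≤ δ := mul_le_of_le_one_right hδ (pow_le_one₀ hρ hρ1.le)
        refine le_trans ?_ (exp_neg_div_one_sub_le (h2.trans_lt hδ1))
        rw [Real.exp_le_exp, neg_le_neg_iff, div_mul_eq_mul_div]
        gcongr

/-- With `y = M v` all three terms are `M^s` times a power of `v`. The extreme exponents `s` and
`s-p` give the two entries of the maximum, and `s-(p-1)` lies between them. -/
theorem rpow_add_rpow_add_rpow_le {y M p s : ℝ} (hy : 0 ≤ y) (hM : 0 < M) (hp : 1 < p)
    (hs : p < s) :
    y ^ s + M ^ p * y ^ (s - p) + M ^ (p - 1) * y ^ (s - (p - 1)) ≤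
      3 * (M * max (y / M) ((y / M) ^ (1 - p / s))) ^ s := by
  obtain ⟨v, hv, rfl⟩ : ∃ v, 0 ≤ v ∧ y = M * v := ⟨y / M, by positivity, by field_simp⟩
  have hs0 : 0 < s := by linarith
  rw [mul_div_cancel_left₀ _ hM.ne']
  set w := max v (v ^ (1 - p / s)) with hw
  have hw0 : 0 ≤ w := hv.trans (le_max_left _ _)
  have h1 : v ^ s ≤ w ^ s := Real.rpow_le_rpow hv (le_max_left _ _) hs0.le
  have h2 : v ^ (s - p) ≤ w ^ s := by
    have : v ^ (s - p) = (v ^ (1 - p / s)) ^ s := by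
      rw [← Real.rpow_mul hv]; congr 1; field_simp
    rw [this]
    exact Real.rpow_le_rpow (Real.rpow_nonneg hv _) (le_max_right _ _) hs0.le
  have h3 : v ^ (s - (p - 1)) ≤ w ^ s := by
    rcases le_total 1 v with h | h
    · exact (Real.rpow_le_rpow_of_exponent_le h (by linarith)).trans h1
    · exact (Real.rpow_le_rpow_of_exponent_ge' hv h (by linarith) (by linarith)).trans h2
  have e : ∀ t, M ^ t * (M * v) ^ (s - t) = M ^ s * v ^ (s - t) := by
    intro t
    rw [Real.mul_rpow hM.le hv, ← mul_assoc, ← Real.rpow_add hM, add_sub_cancel]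
  rw [e, e, Real.mul_rpow hM.le hv, Real.mul_rpow hM.le hw0]
  have h4 : 0 < M ^ s := by positivity
  nlinarith

/-- If the `L^{s n}` norms are bounded by `Q` along `s n → ∞`, so is the `L^∞` norm. -/
theorem ae_abs_le_of_integral_rpow_le {α : Type*} [MeasurableSpace α] {μ : Measure α} {u : α → ℝ}
    {s : ℕ → ℝ} {Q : ℝ} (hQ : 0 ≤ Q) (hs0 : ∀ n, 0 < s n) (hs : Tendsto s atTop atTop)
    (hi : ∀ n, Integrable (fun x => |u x| ^ s n) μ)
    (hle : ∀ n, (∫ x, |u x| ^ s n ∂μ) ^ (1 / s n) ≤ Q) : ∀ᵐ x ∂μ, |u x| ≤ Q := by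
  have key : ∀ Q', Q < Q' → ∀ᵐ x ∂μ, |u x| < Q' := by
    intro Q' hQ'
    have hQ'0 : 0 < Q' := hQ.trans_lt hQ'
    have hset : ∀ n, {x | Q' ^ s n ≤ |u x| ^ s n} = {x | Q' ≤ |u x|} := by
      intro n
      ext x
      exact Real.rpow_le_rpow_iff hQ'0.le (abs_nonneg _) (hs0 n)
    -- Needed because `μ.real` also vanishes on sets of infinite measure.
    have hfin : μ {x | Q' ≤ |u x|} ≠ ⊤ := by
      rw [← hset 0]
      refine ((measure_mono ?_).trans_lt
        ((hi 0).measure_norm_ge_lt_top (Real.rpow_pos_of_pos hQ'0 (s 0)))).ne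
      intro x hx
      have hx' : Q' ^ s 0 ≤ |u x| ^ s 0 := hx
      exact hx'.trans (le_abs_self _)
    -- Chebyshev's inequality for `|u|^(s n)`; the bound tends to zero since `Q < Q'`.
    have hbound : ∀ n, μ.real {x | Q' ≤ |u x|} ≤ (Q / Q') ^ s n := by
      intro n
      have h1 := mul_meas_ge_le_integral_of_nonneg (μ := μ)
        (Eventually.of_forall fun x => Real.rpow_nonneg (abs_nonneg (u x)) (s n)) (hi n)
        (Q' ^ s n)
      rw [hset n] at h1
      have h2 : ∫ x, |u x| ^ s n ∂μ ≤ Q ^ s n := by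
        have := Real.rpow_le_rpow
          (Real.rpow_nonneg (integral_abs_rpow_nonneg u (s n)) _) (hle n) (hs0 n).le
        rwa [← Real.rpow_mul (integral_abs_rpow_nonneg u (s n)),
          one_div_mul_cancel (hs0 n).ne', Real.rpow_one] at this
      rw [Real.div_rpow hQ hQ'0.le, le_div_iff₀ (by positivity), mul_comm]
      exact h1.trans h2
    have hlim : Tendsto (fun n => (Q / Q') ^ s n) atTop (𝓝 0) :=
      (tendsto_rpow_atTop_of_base_lt_one _ (by linarith [div_nonneg hQ hQ'0.le])
        ((div_lt_one hQ'0).2 hQ')).comp hs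
    have hzero : μ.real {x | Q' ≤ |u x|} = 0 :=
      le_antisymm (ge_of_tendsto' hlim hbound) measureReal_nonneg
    rw [measureReal_eq_zero_iff hfin] at hzero
    rw [ae_iff]
    simpa using hzero
  have hall : ∀ᵐ x ∂μ, ∀ n : ℕ, |u x| < Q + 1 / ((n : ℝ) + 1) :=
    ae_all_iff.2 fun n => key _ (by linarith [show 0 < 1 / ((n : ℝ) + 1) by positivity])
  filter_upwards [hall] with x hx
  have hlim : Tendsto (fun n : ℕ => Q + 1 / ((n : ℝ) + 1)) atTop (𝓝 (Q + 0)) :=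
    tendsto_const_nhds.add tendsto_one_div_add_atTop_nhds_zero_nat
  rw [add_zero] at hlim
  exact ge_of_tendsto' hlim fun n => (hx n).le

/-- Summability of `log (s n / p) / s n` along the geometric exponents `s n = β ρ⁻ⁿ`. -/
theorem summable_log_div_geometric {β p ρ κ : ℝ} (hβ : 0 < β) (hp : 0 < p) (hρ : 0 < ρ)
    (hρ1 : ρ < 1) :
    Summable fun n : ℕ => κ * Real.log (β * ρ⁻¹ ^ n / p) / (β * ρ⁻¹ ^ n) := by
  have e : (fun n : ℕ => κ * Real.log (β * ρ⁻¹ ^ n / p) / (β * ρ⁻¹ ^ n)) = fun n : ℕ =>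
      κ * Real.log (β / p) / β * ρ ^ n + κ * Real.log ρ⁻¹ / β * ((n : ℝ) ^ 1 * ρ ^ n) := by
    ext n
    have h1 : β * ρ⁻¹ ^ n / p = β / p * ρ⁻¹ ^ n := by ring
    rw [h1, Real.log_mul (by positivity) (by positivity), Real.log_pow, inv_pow]
    field_simp
  have h1 : Summable fun n : ℕ => ρ ^ n := summable_geometric_of_lt_one hρ.le hρ1
  have h2 : Summable fun n : ℕ => (n : ℝ) ^ 1 * ρ ^ n :=
    summable_pow_mul_geometric_of_norm_lt_one 1 (by rwa [Real.norm_of_nonneg hρ.le])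
  rw [e]
  exact (h1.mul_left _).add (h2.mul_left _)

end MoserIteration

/-! ### Running the iteration and the `L^∞` bound. -/

theorem reverseHolderConst_pos {n p q lam S β₁ D₁ D₂ : ℝ} (hlam : 0 < lam) (hS : 0 < S)
    (hβ₁ : 0 ≤ β₁) (hD₁ : 0 ≤ D₁) (hD₂ : 0 ≤ D₂) :
    0 < reverseHolderConst n p q lam S β₁ D₁ D₂ := by
  have h1 := absorptionConst_pos (n := n) (q := q) hlam hS hD₁
  have h2 := absorptionConst_pos (n := n) (q := q) hlam hS hD₂
  unfold reverseHolderConst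
  positivity

theorem reverseHolderConst_mono {n p q lam S β₁ D₁ D₂ β₁' D₁' D₂' : ℝ} (hn : 0 < n) (hp : 0 < p)
    (hq : n < q) (hlam : 0 < lam) (hS : 0 < S) (hβ₁ : 0 ≤ β₁) (hD₁ : 0 ≤ D₁) (hD₂ : 0 ≤ D₂)
    (h : β₁ ≤ β₁') (h₁ : D₁ ≤ D₁') (h₂ : D₂ ≤ D₂') :
    reverseHolderConst n p q lam S β₁ D₁ D₂ ≤ reverseHolderConst n p q lam S β₁' D₁' D₂' := by
  have e1 := absorptionConst_mono hn hq hlam hS hD₁ h₁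
  have e2 := absorptionConst_mono hn hq hlam hS hD₂ h₂
  unfold reverseHolderConst
  gcongr

/-- Dividing the norms by `M` removes the source terms from the recursion; they survive only as the
exponent defect `p/s`. The exponential is the `s`-th root of `K (s/p)^κ`. -/
theorem IsControlledSolution.moser_step {N : ℕ} {p β lam q : ℝ} (hp : 1 < p)
    (hpN : p < N) (hβ : p < β) (hlam : 0 < lam) (hq : N < q) {S : ℝ} (hS : 0 < S)
    {Ω : Set (EuclideanSpace ℝ (Fin N))}
    (hSob : ∀ (u : EuclideanSpace ℝ (Fin N) → ℝ)
      (G : EuclideanSpace ℝ (Fin N) → EuclideanSpace ℝ (Fin N)), MemBeppoLevi p Ω u G →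
      (∫ x in Ω, |u x| ^ (N * p / (N - p))) ^ ((N - p) / N) ≤ S * ∫ x in Ω, ‖G x‖ ^ p)
    {A : EuclideanSpace ℝ (Fin N) → ℝ → EuclideanSpace ℝ (Fin N) → EuclideanSpace ℝ (Fin N)}
    {B : EuclideanSpace ℝ (Fin N) → ℝ → EuclideanSpace ℝ (Fin N) → ℝ}
    {a₁ a₂ b₁ b₂ b₃ : EuclideanSpace ℝ (Fin N) → ℝ} {u : EuclideanSpace ℝ (Fin N) → ℝ}
    {G : EuclideanSpace ℝ (Fin N) → EuclideanSpace ℝ (Fin N)}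
    (h : IsControlledSolution p β lam q Ω A B a₁ a₂ b₁ b₂ b₃ u G) {s : ℝ} (hs : β ≤ s)
    (hus : Integrable (fun x => |u x| ^ s) (volume.restrict Ω)) {M K : ℝ} (hM : 0 < M)
    (hMa : lebSupNorm Ω (ENNReal.ofReal (β / p)) a₂ ≤ M ^ p)
    (hMb : lebSupNorm Ω (ENNReal.ofReal (β / (p - 1))) b₃ ≤ M ^ (p - 1)) (hK0 : 0 < K)
    (hK : 3 * reverseHolderConst N p q lam S (lpNorm b₁ ⊤ (volume.restrict Ω))
      (lpNorm a₁ (ENNReal.ofReal (q / p)) (volume.restrict Ω))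
      (lpNorm b₂ (ENNReal.ofReal (q / p)) (volume.restrict Ω)) ≤ K) :
    Integrable (fun x => |u x| ^ (s * (N / (N - p)))) (volume.restrict Ω) ∧
      (∫ x in Ω, |u x| ^ (s * (N / (N - p)))) ^ (1 / (s * (N / (N - p)))) / M ≤
        Real.exp (Real.log K / s + (2 * p + p * (N / (q - N))) * Real.log (s / p) / s) *
        max ((∫ x in Ω, |u x| ^ s) ^ (1 / s) / M)
          (((∫ x in Ω, |u x| ^ s) ^ (1 / s) / M) ^ (1 - p / s)) := by
  have hp0 : 0 < p := by linarith
  have hN : (0 : ℝ) < N := by linarith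
  have hNp : 0 < (N : ℝ) - p := by linarith
  have hs0 : 0 < s := by linarith
  obtain ⟨h1, h2⟩ := h.reverse_holder hp hpN hβ hlam hq hS hSob hs hus
  refine ⟨h1, ?_⟩
  set κ := 2 * p + p * (N / (q - N))
  set Θ := reverseHolderConst N p q lam S (lpNorm b₁ ⊤ (volume.restrict Ω))
      (lpNorm a₁ (ENNReal.ofReal (q / p)) (volume.restrict Ω))
      (lpNorm b₂ (ENNReal.ofReal (q / p)) (volume.restrict Ω))
  have hΘ : 0 < Θ := reverseHolderConst_pos hlam hS lpNorm_nonneg lpNorm_nonneg lpNorm_nonneg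
  set J := ∫ x in Ω, |u x| ^ s
  set J' := ∫ x in Ω, |u x| ^ (s * (N / (N - p)))
  have hJ : 0 ≤ J := integral_abs_rpow_nonneg u _
  have hJ' : 0 ≤ J' := integral_abs_rpow_nonneg u _
  set y := J ^ (1 / s) with hy
  have hy0 : 0 ≤ y := Real.rpow_nonneg hJ _
  set w := max (y / M) ((y / M) ^ (1 - p / s)) with hw
  have hw0 : 0 ≤ w := (div_nonneg hy0 hM.le).trans (le_max_left _ _)
  have hJy : ∀ t, J ^ (t / s) = y ^ t := fun t => by
    rw [hy, ← Real.rpow_mul hJ]; congr 1; ring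
  have hJs : J = y ^ s := by rw [← hJy, div_self hs0.ne', Real.rpow_one]
  have hm : 0 < s / p := by positivity
  have hsum : J + lebSupNorm Ω (ENNReal.ofReal (β / p)) a₂ * J ^ ((s - p) / s) +
      lebSupNorm Ω (ENNReal.ofReal (β / (p - 1))) b₃ * J ^ ((s - (p - 1)) / s) ≤
      3 * (M * w) ^ s := by
    refine le_trans ?_ (rpow_add_rpow_add_rpow_le hy0 hM hp (by linarith))
    rw [hJy, hJy, ← hJs]
    gcongr
  have hexp : Real.exp (Real.log K / s + κ * Real.log (s / p) / s) ^ s = K * (s / p) ^ κ := by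
    rw [← Real.exp_mul, show (Real.log K / s + κ * Real.log (s / p) / s) * s =
      Real.log K + Real.log (s / p) * κ by field_simp, Real.exp_add, Real.exp_log hK0,
      Real.rpow_def_of_pos hm]
  have hfin : J' ^ ((N - p) / N) ≤
      (Real.exp (Real.log K / s + κ * Real.log (s / p) / s) * (M * w)) ^ s := by
    rw [Real.mul_rpow (Real.exp_pos _).le (by positivity), hexp]
    calc J' ^ ((N - p) / N) ≤ Θ * (s / p) ^ κ * (3 * (M * w) ^ s) := by
          refine h2.trans ?_
          gcongr
      _ = 3 * Θ * (s / p) ^ κ * (M * w) ^ s := by ring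
      _ ≤ K * (s / p) ^ κ * (M * w) ^ s := by gcongr
  rw [show J' ^ ((N - p) / N) = (J' ^ (1 / (s * (N / (N - p))))) ^ s by
    rw [← Real.rpow_mul hJ']; congr 1; field_simp,
    Real.rpow_le_rpow_iff (Real.rpow_nonneg hJ' _) (by positivity) hs0] at hfin
  rw [div_le_iff₀ hM]
  linarith

/-- The constant in the `L^∞` bound. -/
noncomputable def supBoundConst (n p q β lam S β₁ D₁ D₂ : ℝ) : ℝ :=
  Real.exp (Real.log (max 1 (3 * reverseHolderConst n p q lam S β₁ D₁ D₂)) *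
      (β⁻¹ * (1 - (n - p) / n)⁻¹) +
    ∑' i : ℕ, (2 * p + p * (n / (q - n))) * Real.log (β * ((n - p) / n)⁻¹ ^ i / p) /
      (β * ((n - p) / n)⁻¹ ^ i))

theorem supBoundConst_mono {n p q β lam S β₁ D₁ D₂ β₁' D₁' D₂' : ℝ} (hn : 0 < n) (hp : 0 < p)
    (hq : n < q) (hβ : 0 < β) (hlam : 0 < lam) (hS : 0 < S) (hβ₁ : 0 ≤ β₁) (hD₁ : 0 ≤ D₁)
    (hD₂ : 0 ≤ D₂) (h : β₁ ≤ β₁') (h₁ : D₁ ≤ D₁') (h₂ : D₂ ≤ D₂') :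
    supBoundConst n p q β lam S β₁ D₁ D₂ ≤ supBoundConst n p q β lam S β₁' D₁' D₂' := by
  have h3 : max 1 (3 * reverseHolderConst n p q lam S β₁ D₁ D₂) ≤
      max 1 (3 * reverseHolderConst n p q lam S β₁' D₁' D₂') :=
    max_le_max le_rfl (by linarith [reverseHolderConst_mono hn hp hq hlam hS hβ₁ hD₁ hD₂ h h₁ h₂])
  have h4 : 0 < 1 - (n - p) / n := by
    rw [show 1 - (n - p) / n = p / n by field_simp; ring]; positivity
  have h5 : (0 : ℝ) < max 1 (3 * reverseHolderConst n p q lam S β₁ D₁ D₂) :=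
    lt_max_of_lt_left one_pos
  unfold supBoundConst
  gcongr

theorem IsControlledSolution.integral_rpow_le {N : ℕ} {p β lam q : ℝ} (hp : 1 < p)
    (hpN : p < N) (hβ : p < β) (hlam : 0 < lam) (hq : N < q) {S : ℝ} (hS : 0 < S)
    {Ω : Set (EuclideanSpace ℝ (Fin N))}
    (hSob : ∀ (u : EuclideanSpace ℝ (Fin N) → ℝ)
      (G : EuclideanSpace ℝ (Fin N) → EuclideanSpace ℝ (Fin N)), MemBeppoLevi p Ω u G →
      (∫ x in Ω, |u x| ^ (N * p / (N - p))) ^ ((N - p) / N) ≤ S * ∫ x in Ω, ‖G x‖ ^ p)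
    {A : EuclideanSpace ℝ (Fin N) → ℝ → EuclideanSpace ℝ (Fin N) → EuclideanSpace ℝ (Fin N)}
    {B : EuclideanSpace ℝ (Fin N) → ℝ → EuclideanSpace ℝ (Fin N) → ℝ}
    {a₁ a₂ b₁ b₂ b₃ : EuclideanSpace ℝ (Fin N) → ℝ} {u : EuclideanSpace ℝ (Fin N) → ℝ}
    {G : EuclideanSpace ℝ (Fin N) → EuclideanSpace ℝ (Fin N)}
    (h : IsControlledSolution p β lam q Ω A B a₁ a₂ b₁ b₂ b₃ u G)
    (hu : MemLp u (ENNReal.ofReal β) (volume.restrict Ω)) {M : ℝ} (hM : 1 ≤ M)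
    (hMa : lebSupNorm Ω (ENNReal.ofReal (β / p)) a₂ ≤ M ^ p)
    (hMb : lebSupNorm Ω (ENNReal.ofReal (β / (p - 1))) b₃ ≤ M ^ (p - 1)) (n : ℕ) :
    Integrable (fun x => |u x| ^ (β * (((N : ℝ) - p) / N)⁻¹ ^ n)) (volume.restrict Ω) ∧
      (∫ x in Ω, |u x| ^ (β * (((N : ℝ) - p) / N)⁻¹ ^ n)) ^
          (1 / (β * (((N : ℝ) - p) / N)⁻¹ ^ n)) ≤
        supBoundConst N p q β lam S (lpNorm b₁ ⊤ (volume.restrict Ω))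
          (lpNorm a₁ (ENNReal.ofReal (q / p)) (volume.restrict Ω))
          (lpNorm b₂ (ENNReal.ofReal (q / p)) (volume.restrict Ω)) * M *
        max (lpNorm u (ENNReal.ofReal β) (volume.restrict Ω))
          (lpNorm u (ENNReal.ofReal β) (volume.restrict Ω) ^
            Real.exp (-(p / β / (1 - p / β) * (1 - ((N : ℝ) - p) / N)⁻¹))) := by
  have hp0 : 0 < p := by linarith
  have hN : (0 : ℝ) < N := by linarith
  have hNp : 0 < (N : ℝ) - p := by linarith
  have hβ0 : 0 < β := by linarith
  have hM0 : 0 < M := by linarith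
  -- The maximum with `1` makes `log K` nonnegative, so partial sums are bounded by the full series.
  set K := max 1 (3 * reverseHolderConst N p q lam S (lpNorm b₁ ⊤ (volume.restrict Ω))
      (lpNorm a₁ (ENNReal.ofReal (q / p)) (volume.restrict Ω))
      (lpNorm b₂ (ENNReal.ofReal (q / p)) (volume.restrict Ω))) with hK
  have hK1 : 1 ≤ K := le_max_left _ _
  set ρ := ((N : ℝ) - p) / N with hρ
  have hρ0 : 0 < ρ := by positivity
  have hρ1 : ρ < 1 := by rw [hρ, div_lt_one hN]; linarith
  have hχ1 : 1 ≤ ρ⁻¹ := (one_le_inv₀ hρ0).2 hρ1.le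
  set κ := 2 * p + p * (N / (q - N)) with hκ
  have hκ0 : 0 ≤ κ := by
    have : 0 < N / (q - N) := div_pos hN (by linarith)
    positivity
  set s : ℕ → ℝ := fun i => β * ρ⁻¹ ^ i with hs
  have hsβ : ∀ i, β ≤ s i := fun i => le_mul_of_one_le_right hβ0.le (one_le_pow₀ hχ1)
  have hs0 : ∀ i, 0 < s i := fun i => hβ0.trans_le (hsβ i)
  have hsucc : ∀ i, s (i + 1) = s i * (N / (N - p)) := fun i => by
    simp only [hs, pow_succ, hρ, inv_div]; ring
  have hstep := fun i hi => h.moser_step hp hpN hβ hlam hq hS hSob (hsβ i) hi hM0 hMa hMb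
    (by linarith) (le_max_right 1 _)
  have hint : ∀ i, Integrable (fun x => |u x| ^ s i) (volume.restrict Ω) := by
    intro i
    induction i with
    | zero =>
      simp only [hs, pow_zero, mul_one]
      exact (memLp_ofReal_iff_integrable_abs_rpow hu.1 hβ0).1 hu
    | succ i ih => rw [hsucc]; exact (hstep i ih).1
  refine ⟨hint n, ?_⟩
  set v : ℕ → ℝ := fun i => (∫ x in Ω, |u x| ^ s i) ^ (1 / s i) / M with hv
  have hv0 : ∀ i, 0 ≤ v i := fun i =>
    div_nonneg (Real.rpow_nonneg (integral_abs_rpow_nonneg u _) _) hM0.le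
  have hlogK : 0 ≤ Real.log K := Real.log_nonneg hK1
  have hlogs : ∀ i, 0 ≤ κ * Real.log (s i / p) / s i := fun i => by
    have : 0 ≤ Real.log (s i / p) :=
      Real.log_nonneg ((one_le_div hp0).2 (by linarith [hsβ i]))
    have := hs0 i
    positivity
  have hδ : ∀ i, p / s i = p / β * ρ ^ i := fun i => by
    simp only [hs, inv_pow]; field_simp
  have hδ1 : p / β < 1 := (div_lt_one hβ0).2 hβ
  have hiter := iterate_le_exp_sum_mul_max (v := v)
    (k := fun i => Real.log K / s i + κ * Real.log (s i / p) / s i) (δ := fun i => p / s i) hv0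
    (fun i => add_nonneg (div_nonneg hlogK (hs0 i).le) (hlogs i))
    (fun i => div_nonneg hp0.le (hs0 i).le)
    (fun i => (div_lt_one (hs0 i)).2 (by linarith [hsβ i]))
    (fun i => by
      have := (hstep i (hint i)).2
      rw [← hsucc] at this
      exact this) n
  have hsumle : ∑ i ∈ Finset.range n, (Real.log K / s i + κ * Real.log (s i / p) / s i) ≤
      Real.log K * (β⁻¹ * (1 - ρ)⁻¹) + ∑' i : ℕ, κ * Real.log (s i / p) / s i := by
    rw [Finset.sum_add_distrib]
    refine add_le_add ?_ ((summable_log_div_geometric hβ0 hp0 hρ0 hρ1).sum_le_tsum _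
      fun i _ => hlogs i)
    rw [Finset.sum_congr rfl fun i _ => show Real.log K / s i = Real.log K * (β⁻¹ * ρ ^ i) by
      simp only [hs, inv_pow]; field_simp, ← Finset.mul_sum, ← Finset.mul_sum,
      ← tsum_geometric_of_lt_one hρ0.le hρ1]
    gcongr
    exact (summable_geometric_of_lt_one hρ0.le hρ1).sum_le_tsum _ fun i _ => by positivity
  set θ₀ := Real.exp (-(p / β / (1 - p / β) * (1 - ρ)⁻¹)) with hθ₀
  have hprod : θ₀ ≤ ∏ i ∈ Finset.range n, (1 - p / s i) := by
    simp_rw [hδ]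
    exact exp_le_prod_one_sub_geometric (by positivity) hδ1 hρ0.le hρ1 n
  -- The initial exponent is `β`, and dividing by `M ≥ 1` only decreases the norm.
  have hv0le : v 0 ≤ lpNorm u (ENNReal.ofReal β) (volume.restrict Ω) := by
    have e : v 0 = lpNorm u (ENNReal.ofReal β) (volume.restrict Ω) / M := by
      simp only [hv, hs, pow_zero, mul_one]
      rw [lpNorm_ofReal_eq hu.1 hβ0]
    rw [e]
    exact div_le_self lpNorm_nonneg hM
  set y := lpNorm u (ENNReal.ofReal β) (volume.restrict Ω) with hy
  -- The exponent depending on `n` is traded for its lower bound `θ₀`: if `v 0 ≥ 1` the maximum is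
  -- `v 0`, and if `v 0 ≤ 1` a smaller exponent gives a larger power.
  have hmax : max (v 0) (v 0 ^ (∏ i ∈ Finset.range n, (1 - p / s i))) ≤ max y (y ^ θ₀) := by
    refine le_trans ?_ (max_le_max hv0le (Real.rpow_le_rpow (hv0 0) hv0le (Real.exp_pos _).le))
    refine max_le (le_max_left _ _) ?_
    rcases le_total 1 (v 0) with h1 | h1
    · refine le_trans (Real.rpow_le_self_of_one_le h1 ?_) (le_max_left _ _)
      refine Finset.prod_le_one (fun i _ => ?_) fun i _ => ?_
      · linarith [(div_lt_one (hs0 i)).2 (by linarith [hsβ i] : p < s i)]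
      · linarith [div_nonneg hp0.le (hs0 i).le]
    · exact (Real.rpow_le_rpow_of_exponent_ge' (hv0 0) h1 (Real.exp_pos _).le hprod).trans
        (le_max_right _ _)
  have hmax0 : 0 ≤ max (v 0) (v 0 ^ (∏ i ∈ Finset.range n, (1 - p / s i))) :=
    (hv0 0).trans (le_max_left _ _)
  have hfin := hiter.trans (mul_le_mul (Real.exp_le_exp.2 hsumle) hmax hmax0 (Real.exp_pos _).le)
  simp only [hv] at hfin
  rw [div_le_iff₀ hM0] at hfin
  refine hfin.trans_eq ?_
  rw [supBoundConst]
  ring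

theorem corollary2p4 (N : ℕ) (p β : ℝ) (hp : 1 < p) (hpN : p < (N : ℝ)) (hβ : p < β) :
    ∃ θ₀ : ℝ, 0 < θ₀ ∧ θ₀ ≤ 1 ∧
      ∀ lam q : ℝ, 0 < lam → (N : ℝ) < q →
        ∃ C : ℝ × ℝ × ℝ → ℝ, Monotone C ∧
          ∀ Ω : Set (EuclideanSpace ℝ (Fin N)), IsOpen Ω →
          ∀ (A : EuclideanSpace ℝ (Fin N) → ℝ → EuclideanSpace ℝ (Fin N) →
              EuclideanSpace ℝ (Fin N))
            (B : EuclideanSpace ℝ (Fin N) → ℝ → EuclideanSpace ℝ (Fin N) → ℝ)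
            (a₁ a₂ b₁ b₂ b₃ : EuclideanSpace ℝ (Fin N) → ℝ),
          IsCaratheodory Ω A → IsCaratheodory Ω B →
          (∀ᵐ x ∂(volume.restrict Ω),
            0 ≤ a₁ x ∧ 0 ≤ a₂ x ∧ 0 ≤ b₁ x ∧ 0 ≤ b₂ x ∧ 0 ≤ b₃ x) →
          StructureA p lam Ω A a₁ a₂ → StructureB p Ω B b₁ b₂ b₃ →
          MemLp b₁ ⊤ (volume.restrict Ω) →
          MemLp a₁ (ENNReal.ofReal (q / p)) (volume.restrict Ω) →
          MemLp b₂ (ENNReal.ofReal (q / p)) (volume.restrict Ω) →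
          MemLp a₂ (ENNReal.ofReal (β / p)) (volume.restrict Ω) →
          MemLp a₂ ⊤ (volume.restrict Ω) →
          MemLp b₃ (ENNReal.ofReal (β / (p - 1))) (volume.restrict Ω) →
          MemLp b₃ ⊤ (volume.restrict Ω) →
          ∀ (u : EuclideanSpace ℝ (Fin N) → ℝ)
            (G : EuclideanSpace ℝ (Fin N) → EuclideanSpace ℝ (Fin N)),
          IsWeakSolution p Ω A B u G →
          MemLp u (ENNReal.ofReal β) (volume.restrict Ω) →
          MemLp u ⊤ (volume.restrict Ω) ∧
          lpNorm u ⊤ (volume.restrict Ω) ≤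
            C (lpNorm b₁ ⊤ (volume.restrict Ω), lpNorm a₁ (ENNReal.ofReal (q / p)) (volume.restrict Ω),
                lpNorm b₂ (ENNReal.ofReal (q / p)) (volume.restrict Ω)) *
              max 1 (max (lebSupNorm Ω (ENNReal.ofReal (β / p)) a₂ ^ (1 / p))
                (lebSupNorm Ω (ENNReal.ofReal (β / (p - 1))) b₃ ^ (1 / (p - 1)))) *
              max (lpNorm u (ENNReal.ofReal β) (volume.restrict Ω))
                (lpNorm u (ENNReal.ofReal β) (volume.restrict Ω) ^ θ₀) := by
  obtain ⟨S, hS, hSob⟩ := exists_integral_sobolev_constant N hp hpN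
  have hp0 : 0 < p := by linarith
  have hN : (0 : ℝ) < N := by linarith
  have hNp : 0 < (N : ℝ) - p := by linarith
  have hβ0 : 0 < β := by linarith
  have hδ1 : p / β < 1 := (div_lt_one hβ0).2 hβ
  have hρ0 : 0 < ((N : ℝ) - p) / N := by positivity
  have hρ1 : ((N : ℝ) - p) / N < 1 := by rw [div_lt_one hN]; linarith
  refine ⟨Real.exp (-(p / β / (1 - p / β) * (1 - ((N : ℝ) - p) / N)⁻¹)), Real.exp_pos _, ?_,
    -- `C` must be monotone on all real triples, so its arguments are cut off at `0`; this changes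
    -- nothing for norms.
    fun lam q hlam hq => ⟨fun z => supBoundConst N p q β lam S (max z.1 0) (max z.2.1 0)
      (max z.2.2 0), ?_, ?_⟩⟩
  · rw [Real.exp_le_one_iff, neg_nonpos]
    have h1 : 0 < 1 - p / β := by linarith
    have h2 : 0 < 1 - ((N : ℝ) - p) / N := by linarith
    positivity
  · intro z z' hz
    exact supBoundConst_mono hN hp0 hq hβ0 hlam hS (le_max_right _ _) (le_max_right _ _)
      (le_max_right _ _) (max_le_max hz.1 le_rfl) (max_le_max hz.2.1 le_rfl)
      (max_le_max hz.2.2 le_rfl)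
  intro Ω _ A B a₁ a₂ b₁ b₂ b₃ _ _ hnn hA hB hb₁ ha₁ hb₂ ha₂ ha₂' hb₃ hb₃' u G hsol hu
  have h : IsControlledSolution p β lam q Ω A B a₁ a₂ b₁ b₂ b₃ u G :=
    ⟨hnn, hA, hB, hb₁, ha₁, hb₂, ha₂, ha₂', hb₃, hb₃', hsol⟩
  simp only [max_eq_left lpNorm_nonneg]
  set M := max 1 (max (lebSupNorm Ω (ENNReal.ofReal (β / p)) a₂ ^ (1 / p))
    (lebSupNorm Ω (ENNReal.ofReal (β / (p - 1))) b₃ ^ (1 / (p - 1)))) with hM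
  have hle : ∀ {T t : ℝ}, 0 ≤ T → 0 < t → T ^ (1 / t) ≤ M → T ≤ M ^ t := by
    intro T t hT ht hTM
    have := Real.rpow_le_rpow (Real.rpow_nonneg hT _) hTM ht.le
    rwa [← Real.rpow_mul hT, one_div_mul_cancel ht.ne', Real.rpow_one] at this
  have hMa : lebSupNorm Ω (ENNReal.ofReal (β / p)) a₂ ≤ M ^ p :=
    hle (add_nonneg lpNorm_nonneg lpNorm_nonneg) hp0
      ((le_max_left _ _).trans (le_max_right _ _))
  have hMb : lebSupNorm Ω (ENNReal.ofReal (β / (p - 1))) b₃ ≤ M ^ (p - 1) :=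
    hle (add_nonneg lpNorm_nonneg lpNorm_nonneg) (by linarith)
      ((le_max_right _ _).trans (le_max_right _ _))
  have hM1 : 1 ≤ M := le_max_left _ _
  have hbound := h.integral_rpow_le hp hpN hβ hlam hq hS (hSob Ω) hu hM1 hMa hMb
  set Q := supBoundConst N p q β lam S (lpNorm b₁ ⊤ (volume.restrict Ω))
    (lpNorm a₁ (ENNReal.ofReal (q / p)) (volume.restrict Ω))
    (lpNorm b₂ (ENNReal.ofReal (q / p)) (volume.restrict Ω)) * M *
    max (lpNorm u (ENNReal.ofReal β) (volume.restrict Ω))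
      (lpNorm u (ENNReal.ofReal β) (volume.restrict Ω) ^
        Real.exp (-(p / β / (1 - p / β) * (1 - ((N : ℝ) - p) / N)⁻¹))) with hQ
  have hQ0 : 0 ≤ Q :=
    mul_nonneg (mul_nonneg (Real.exp_pos _).le (by linarith))
      (lpNorm_nonneg.trans (le_max_left _ _))
  have hae : ∀ᵐ x ∂(volume.restrict Ω), ‖u x‖ ≤ Q :=
    ae_abs_le_of_integral_rpow_le hQ0 (fun n => by positivity)
      ((tendsto_pow_atTop_atTop_of_one_lt ((one_lt_inv₀ hρ0).2 hρ1)).const_mul_atTop hβ0)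
      (fun n => (hbound n).1) (fun n => (hbound n).2)
  have hmem : MemLp u ⊤ (volume.restrict Ω) := memLp_top_of_bound hu.1 Q hae
  refine ⟨hmem, ?_⟩
  rw [← toReal_eLpNorm hu.1]
  refine ENNReal.toReal_le_of_le_ofReal hQ0 ?_
  rw [eLpNorm_exponent_top]
  exact eLpNormEssSup_le_of_ae_bound hae
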